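/- Let $k\ge 1$ be an integer and $0\le\alpha<1$, let $\mathbb D=\{z\in\mathbb C:|z|<1\}$, and let $d$ denote Euclidean distance. Let $S^{k*}_{LH}(\alpha)$ be the class of univalent mappings $f:\mathbb D\to\mathbb C$ of the form $f(z)=z\,h(z)\overline{g(z)}$ with $h,g$ analytic in $\mathbb D$, $$h(z)=\exp\Big(\sum_{n=1}^\infty a_{nk}z^{nk}\Big),\qquad g(z)=\exp\Big(\sum_{n=1}^\infty b_{nk}z^{nk}\Big),$$ that are $k$-fold symmetric, $f(e^{2\pi i/k}z)=e^{2\pi i/k}f(z)$, logharmonic, that is, $\overline{f_{\bar z}}/\overline{f}=\omega f_z/f$ for some analytic $\omega$ on $\mathbb D$ with $|\omega|<1$, and starlike of order $\alpha$, that is, $\operatorname{Re}\big((zf_z-\bar z f_{\bar z})/f\big)>\alpha$ in $\mathbb D\setminus\{0\}$. **Theorem.** The equation $$\frac{2^{2\alpha/k}\,r\,\big(2-(1+2\alpha)r^k+r^{2k}\big)}{(1-r^k)^{2(\alpha+k)/k}}\exp\Big(\frac{2(1-\alpha)(1+r^k)}{k(1-r^k)}\Big)=1$$ has a unique root $r_6$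 in $(0,1)$. For every $f\in S^{k*}_{LH}(\alpha)$ with $\omega(0)=0$ and every real $\theta$, $$|zf_z(z)|+|z|\exp\Big(\sum_{n=1}^\infty|a_{nk}+e^{i\theta}b_{nk}|\,|z|^{nk}\Big)\le d\big(f(0),\partial f(\mathbb D)\big)\qquad\text{for }|z|\le r_6,$$ where the series converges. The radius $r_6$ is best possible: for every $\rho\in(r_6,1)$ there are $f\in S^{k*}_{LH}(\alpha)$ with $\omega(0)=0$, a real $\theta$ and a point $z$ with $|z|=\rho$ for which the inequality fails. -/

import Mathlib

open scoped ComplexConjugate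

noncomputable section

/-- The Wirtinger derivative `f_z = (f_x - i f_y) / 2`. -/
def wirtingerZ (f : ℂ → ℂ) (z : ℂ) : ℂ :=
  (fderiv ℝ f z 1 - Complex.I * fderiv ℝ f z Complex.I) / 2

/-- The Wirtinger derivative `f_{z̄} = (f_x + i f_y) / 2`. -/
def wirtingerZbar (f : ℂ → ℂ) (z : ℂ) : ℂ :=
  (fderiv ℝ f z 1 + Complex.I * fderiv ℝ f z Complex.I) / 2

/-- The open unit disk. -/
def unitDisk : Set ℂ := Metric.ball 0 1

/-- `f` is a solution in the unit disk of `conj(f_{z̄}) / conj(f) = ω f_z / f`, where the second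
dilatation `ω` is analytic with `|ω| < 1`. The equation is written without denominators, so that
at the zeros of `f` (for the mappings below only the origin) it imposes nothing. -/
structure IsLogharmonicWith (f ω : ℂ → ℂ) : Prop where
  realDifferentiable : ∀ z ∈ unitDisk, DifferentiableAt ℝ f z
  dilatation_analytic : AnalyticOnNhd ℂ ω unitDisk
  dilatation_lt_one : ∀ z ∈ unitDisk, ‖ω z‖ < 1
  equation : ∀ z ∈ unitDisk,
    conj (wirtingerZbar f z) * f z = ω z * wirtingerZ f z * conj (f z)

/-- `f(e^{2πi/k} z) = e^{2πi/k} f(z)` in the unit disk. -/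
def IsKFoldSymmetric (k : ℕ) (f : ℂ → ℂ) : Prop :=
  ∀ z ∈ unitDisk,
    f (Complex.exp (2 * Real.pi * Complex.I / k) * z)
      = Complex.exp (2 * Real.pi * Complex.I / k) * f z

/-- `Re (D f / f) > α`, `D f = z f_z - z̄ f_{z̄}`. The origin, where the quotient is `0 / 0`
(with limit `1`), is left out. -/
def IsStarlikeOfOrder (α : ℝ) (f : ℂ → ℂ) : Prop :=
  ∀ z ∈ unitDisk, z ≠ 0 →
    α < ((z * wirtingerZ f z - conj z * wirtingerZbar f z) / f z).re

/-- `u(z) = exp (∑_{n ≥ 1} c_{nk} z^{nk})` in the unit disk, with a series that converges there. -/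
def IsExpSeries (k : ℕ) (c : ℕ → ℂ) (u : ℂ → ℂ) : Prop :=
  ∀ z ∈ unitDisk, ∃ s : ℂ,
    HasSum (fun n : ℕ => c ((n + 1) * k) * z ^ ((n + 1) * k)) s ∧ u z = Complex.exp s

/-- `f = z h conj(g)` belongs to the class `S_LH^{k*}(α)`, where `h` and `g` are the exponentials
of the power series with coefficients `a_{nk}` and `b_{nk}`, and where `f` is logharmonic with
second dilatation `ω`. -/
structure IsSLHkStar (k : ℕ) (α : ℝ) (f h g ω : ℂ → ℂ) (a b : ℕ → ℂ) : Prop where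
  h_analytic : AnalyticOnNhd ℂ h unitDisk
  g_analytic : AnalyticOnNhd ℂ g unitDisk
  h_series : IsExpSeries k a h
  g_series : IsExpSeries k b g
  representation : ∀ z ∈ unitDisk, f z = z * h z * conj (g z)
  univalent : Set.InjOn f unitDisk
  logharmonic : IsLogharmonicWith f ω
  symmetric : IsKFoldSymmetric k f
  starlike : IsStarlikeOfOrder α f

/-- The terms `|a_{nk} + e^{iθ} b_{nk}| |z|^{nk}`; the index `n : ℕ` stands for `n + 1 ≥ 1`. -/
def bohrTerm (k : ℕ) (a b : ℕ → ℂ) (θ : ℝ) (z : ℂ) (n : ℕ) : ℝ :=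
  ‖a ((n + 1) * k) + Complex.exp (θ * Complex.I) * b ((n + 1) * k)‖ * ‖z‖ ^ ((n + 1) * k)

/-- `|z f_z(z)| + |z| exp (∑_{n ≥ 1} |a_{nk} + e^{iθ} b_{nk}| |z|^{nk})`. -/
def bohrMajorant (k : ℕ) (f : ℂ → ℂ) (a b : ℕ → ℂ) (θ : ℝ) (z : ℂ) : ℝ :=
  ‖z * wirtingerZ f z‖ + ‖z‖ * Real.exp (∑' n : ℕ, bohrTerm k a b θ z n)

/-- The Euclidean distance from `f(0)` to the boundary of the image of the unit disk. -/
def boundaryDist (f : ℂ → ℂ) : ℝ :=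
  Metric.infDist (f 0) (frontier (f '' unitDisk))

/-- The left-hand side of the equation that determines the radius. -/
def radiusFunction (k : ℕ) (α r : ℝ) : ℝ :=
  (2 : ℝ) ^ (2 * α / k) * r * (2 - (1 + 2 * α) * r ^ k + r ^ (2 * k))
      / (1 - r ^ k) ^ (2 * (α + k) / k)
    * Real.exp (2 * (1 - α) * (r ^ k + 1) / (k * (1 - r ^ k)))

end

/-!
Write `h = exp A(z ^ k)` and `g = exp B(z ^ k)`. In the variable `x = z ^ k` the quantities
`U = z f_z / f = 1 + k x A'(x)` and `V = k x B'(x)` are analytic, `Re (U - V) > α` is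
starlikeness, and `|V| < |U|` bounds the dilatation. Hence `p = U - V` and `q = (U + V) / (U - V)`
have real parts greater than `α` and `0` and are `1` at the origin, while `U = p (q + 1) / 2` and
`V = p (q - 1) / 2`. Carathéodory's inequality for the coefficients of `p` and `q` gives sharp
bounds for those of `A`, `B` and `U`, and with them a sharp increasing bound for the Bohr
majorant.

For the distance to the boundary, `H = k (A + B)` satisfies `1 + x H' = U + V = p q`. Write
`H = α K + (1 - α) L` with `x K' = q - 1`. Then `Re K ≥ -2 log 2`, and `Re L > -2` by Jack's
lemma, because `1 + x L'` is a product of two functions with positive real part and so is never a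
negative number. This gives `|f z| ≥ |z| exp (-(2 α log 2 + 2 (1 - α)) / k)`, and the ratio of the
two bounds is the left-hand side of the equation for the radius.

All the bounds are attained by the mapping with `q = (1 + x) / (1 - x)` and
`p = (1 + (1 - 2 α) x) / (1 - x)`. It is univalent because its `k`-th power is an injective
function of `y = 1 / (1 - z ^ k)`: for `y` in the upper half-plane the angles `arg y` and
`arg (y - 1)` are coordinates, and along each level curve of the argument of that function its
modulus is strictly increasing.
-/

open Metric Set Filter Topology
open Finset.HasAntidiagonal (antidiagonal mem_antidiagonal)

/-! ### Power series in the unit disk -/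

theorem pow_mem_ball_zero_one_iff {m : ℕ} [NeZero m] {z : ℂ} :
    z ^ m ∈ ball (0 : ℂ) 1 ↔ z ∈ ball (0 : ℂ) 1 := by
  simp only [mem_ball_zero_iff, norm_pow, pow_lt_one_iff_of_nonneg (norm_nonneg z) (NeZero.ne m)]

theorem exists_pow_eq_mem_ball (m : ℕ) [NeZero m] {x : ℂ} (hx : x ∈ ball (0 : ℂ) 1) :
    ∃ z ∈ ball (0 : ℂ) 1, z ^ m = x := by
  obtain ⟨z, rfl⟩ := IsAlgClosed.exists_pow_nat_eq x (NeZero.pos m)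
  exact ⟨z, pow_mem_ball_zero_one_iff.1 hx, rfl⟩

/-- `F` is the sum in the open unit disk of the power series with coefficients `c`: the scalar form
of `HasFPowerSeriesOnBall F _ 0 1`, suited to coefficient estimates. -/
def HasDiskSeries (F : ℂ → ℂ) (c : ℕ → ℂ) : Prop :=
  ∀ x ∈ ball (0 : ℂ) 1, HasSum (fun n => c n * x ^ n) (F x)

namespace HasDiskSeries

variable {F G : ℂ → ℂ} {c d : ℕ → ℂ}

theorem hasFPowerSeriesOnBall (hF : HasDiskSeries F c) :
    HasFPowerSeriesOnBall F (FormalMultilinearSeries.ofScalars ℂ c) 0 1 where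
  r_le := by
    refine ENNReal.le_of_forall_nnreal_lt fun r hr => ?_
    have hr_mem : ((r : ℝ) : ℂ) ∈ ball (0 : ℂ) 1 := by simpa using mod_cast hr
    refine FormalMultilinearSeries.le_radius_of_summable_norm _
      ((hF _ hr_mem).summable.norm.congr fun n => ?_)
    rw [FormalMultilinearSeries.ofScalars_norm]
    simp
  r_pos := one_pos
  hasSum {y} hy := by
    have hy_mem : y ∈ ball (0 : ℂ) 1 := by
      rwa [← ENNReal.ofReal_one, Metric.eball_ofReal] at hy
    simpa [FormalMultilinearSeries.ofScalars_apply_eq, mul_comm] using hF y hy_mem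

theorem unique (hc : HasDiskSeries F c) (hd : HasDiskSeries F d) : c = d := by
  have h := hc.hasFPowerSeriesOnBall.hasFPowerSeriesAt.eq_formalMultilinearSeries
    hd.hasFPowerSeriesOnBall.hasFPowerSeriesAt
  funext n
  simpa [FormalMultilinearSeries.coeff_ofScalars] using
    congrArg (fun p => FormalMultilinearSeries.coeff p n) h

theorem differentiableOn (hF : HasDiskSeries F c) : DifferentiableOn ℂ F (ball 0 1) := by
  have h := hF.hasFPowerSeriesOnBall.differentiableOn
  rwa [← ENNReal.ofReal_one, Metric.eball_ofReal] at h

theorem taylor (hF : DifferentiableOn ℂ F (ball 0 1)) :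
    HasDiskSeries F (fun n => (n.factorial : ℂ)⁻¹ * iteratedDeriv n F 0) := fun x hx =>
  (Complex.hasSum_taylorSeries_on_ball hF hx).congr_fun fun n => by
    simp only [sub_zero, smul_eq_mul]
    ring

theorem apply_zero (hF : HasDiskSeries F c) : F 0 = c 0 := by
  simpa using (hF 0 (by simp)).unique
    (hasSum_single (f := fun n => c n * (0 : ℂ) ^ n) 0 fun n hn => by simp [hn])

theorem deriv_zero (hF : HasDiskSeries F c) : deriv F 0 = c 1 := by
  rw [hF.unique (taylor hF.differentiableOn)]
  simp

theorem congr_ball (hF : HasDiskSeries F c) (hFG : EqOn G F (ball 0 1)) : HasDiskSeries G c :=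
  fun x hx => hFG hx ▸ hF x hx

theorem const (e : ℂ) : HasDiskSeries (fun _ => e) (Pi.single 0 e) := fun x _ => by
  simpa using hasSum_single (f := fun n => (Pi.single 0 e : ℕ → ℂ) n * x ^ n) 0
    fun n hn => by simp [hn]

theorem add (hF : HasDiskSeries F c) (hG : HasDiskSeries G d) :
    HasDiskSeries (fun x => F x + G x) (fun n => c n + d n) := fun x hx =>
  ((hF x hx).add (hG x hx)).congr_fun fun n => by ring

theorem const_mul (hF : HasDiskSeries F c) (e : ℂ) :
    HasDiskSeries (fun x => e * F x) (fun n => e * c n) := fun x hx =>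
  ((hF x hx).mul_left e).congr_fun fun n => by ring

theorem mul (hF : HasDiskSeries F c) (hG : HasDiskSeries G d) :
    HasDiskSeries (fun x => F x * G x)
      (fun n => ∑ ij ∈ antidiagonal n, c ij.1 * d ij.2) := by
  intro x hx
  have hterm (n : ℕ) : (∑ ij ∈ antidiagonal n, c ij.1 * d ij.2) * x ^ n =
      ∑ ij ∈ antidiagonal n, (c ij.1 * x ^ ij.1) * (d ij.2 * x ^ ij.2) := by
    rw [Finset.sum_mul]
    refine Finset.sum_congr rfl fun ij hij => ?_
    rw [← mem_antidiagonal.1 hij, pow_add]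
    ring
  simp only [hterm]
  rw [← (hF x hx).tsum_eq, ← (hG x hx).tsum_eq,
    tsum_mul_tsum_eq_tsum_sum_antidiagonal_of_summable_norm
      (hF x hx).summable.norm (hG x hx).summable.norm]
  exact (summable_norm_sum_mul_antidiagonal_of_summable_norm
    (hF x hx).summable.norm (hG x hx).summable.norm).of_norm.hasSum

theorem mul_deriv (hF : HasDiskSeries F c) :
    HasDiskSeries (fun x => x * deriv F x) (fun n => n * c n) := by
  intro x hx
  have hderiv := (taylor (hF.differentiableOn.deriv isOpen_ball) x hx).mul_left x
  rw [← hasSum_nat_add_iff' 1]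
  simp only [Finset.range_one, Finset.sum_singleton, Nat.cast_zero, zero_mul, sub_zero]
  refine hderiv.congr_fun fun n => ?_
  have hn : (n : ℂ) + 1 ≠ 0 := by exact_mod_cast n.succ_ne_zero
  simp only [hF.unique (taylor hF.differentiableOn), iteratedDeriv_succ', Nat.factorial_succ,
    pow_succ, Nat.cast_mul, Nat.cast_add, Nat.cast_one]
  field_simp

end HasDiskSeries

/-! ### Functions with positive real part -/

theorem sum_pow_primitiveRoot {ζ : ℂ} {m : ℕ} (hζ : IsPrimitiveRoot ζ m) (n : ℕ) :
    ∑ j ∈ Finset.range m, (ζ ^ j) ^ n = if m ∣ n then (m : ℂ) else 0 := by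
  simp only [pow_right_comm ζ _ n]
  split_ifs with hmn
  · simp [(hζ.pow_eq_one_iff_dvd n).2 hmn]
  · have hne : ζ ^ n - 1 ≠ 0 := sub_ne_zero.2 fun h => hmn ((hζ.pow_eq_one_iff_dvd n).1 h)
    refine (mul_eq_zero.1 ?_).resolve_left hne
    rw [mul_geom_sum, pow_right_comm, hζ.pow_eq_one, one_pow, sub_self]

theorem HasDiskSeries.hasSum_coeff_mul {F : ℂ → ℂ} {c : ℕ → ℂ} (hF : HasDiskSeries F c) {ζ : ℂ}
    {m : ℕ} [NeZero m] (hζ : IsPrimitiveRoot ζ m) {x : ℂ} (hx : x ∈ ball (0 : ℂ) 1) :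
    HasSum (fun n => c (n * m) * (x ^ m) ^ n)
      ((m : ℂ)⁻¹ * ∑ j ∈ Finset.range m, F (ζ ^ j * x)) := by
  have hm : (m : ℂ) ≠ 0 := NeZero.ne _
  have hmem (j : ℕ) : ζ ^ j * x ∈ ball (0 : ℂ) 1 := by
    simpa [hζ.norm'_eq_one (NeZero.ne m)] using hx
  have hsum := (hasSum_sum fun j (_ : j ∈ Finset.range m) => hF _ (hmem j)).mul_left (m : ℂ)⁻¹
  have hterm (n : ℕ) : (m : ℂ)⁻¹ * ∑ j ∈ Finset.range m, c n * (ζ ^ j * x) ^ n =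
      if m ∣ n then c n * x ^ n else 0 := by
    simp only [mul_pow, ← Finset.mul_sum, ← Finset.sum_mul, sum_pow_primitiveRoot hζ]
    split_ifs <;> field_simp
    ring
  simp only [hterm] at hsum
  have hinj : Function.Injective fun n : ℕ => n * m := fun i j => Nat.eq_of_mul_eq_mul_right
    (NeZero.pos m)
  rw [← hinj.hasSum_iff fun n hn => if_neg fun ⟨i, hi⟩ => hn ⟨i, by simp [hi, mul_comm]⟩] at hsum
  refine hsum.congr_fun fun n => ?_
  simp [pow_mul, mul_comm n m]

theorem add_one_ne_zero_of_re_nonneg {w : ℂ} (hw : 0 ≤ w.re) : w + 1 ≠ 0 := fun h => by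
  have := congrArg Complex.re h
  simp only [Complex.add_re, Complex.one_re, Complex.zero_re] at this
  linarith

theorem norm_cayley_le_one {w : ℂ} (hw : 0 ≤ w.re) : ‖(w - 1) / (w + 1)‖ ≤ 1 := by
  rw [norm_div, div_le_one (norm_pos_iff.2 (add_one_ne_zero_of_re_nonneg hw)),
    ← sq_le_sq₀ (norm_nonneg _) (norm_nonneg _), Complex.sq_norm, Complex.sq_norm,
    Complex.normSq_apply, Complex.normSq_apply]
  simp only [Complex.sub_re, Complex.one_re, Complex.sub_im, Complex.one_im, sub_zero,
    Complex.add_re, Complex.add_im, add_zero]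
  linarith

theorem le_re_of_norm_cayley_le {w : ℂ} {t : ℝ} (hw : 0 ≤ w.re) (ht : t ≤ 1)
    (h : ‖(w - 1) / (w + 1)‖ ≤ t) : (1 - t) / (1 + t) ≤ w.re := by
  have ht0 : 0 ≤ t := (norm_nonneg _).trans h
  rw [norm_div, div_le_iff₀ (norm_pos_iff.2 (add_one_ne_zero_of_re_nonneg hw)),
    ← sq_le_sq₀ (norm_nonneg _) (by positivity), mul_pow, Complex.sq_norm, Complex.sq_norm,
    Complex.normSq_apply, Complex.normSq_apply] at h
  simp only [Complex.sub_re, Complex.one_re, Complex.sub_im, Complex.one_im, sub_zero,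
    Complex.add_re, Complex.add_im, add_zero] at h
  have hsq : (w.re - 1) ^ 2 ≤ (t * (w.re + 1)) ^ 2 := by
    have : t ^ 2 ≤ 1 := pow_le_one₀ ht0 ht
    nlinarith [mul_nonneg (sub_nonneg.2 this) (mul_self_nonneg w.im)]
  rw [div_le_iff₀ (by positivity)]
  linarith [(abs_le_of_sq_le_sq' hsq (by positivity)).1]

section PositiveRealPart

variable {G : ℂ → ℂ} {s : ℝ}

theorem differentiableOn_cayley (hG : DifferentiableOn ℂ G (ball 0 s))
    (hre : ∀ x ∈ ball (0 : ℂ) s, 0 ≤ (G x).re) :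
    DifferentiableOn ℂ (fun x => (G x - 1) / (G x + 1)) (ball 0 s) :=
  (hG.sub_const 1).div (hG.add_const 1) fun x hx => add_one_ne_zero_of_re_nonneg (hre x hx)

theorem mapsTo_cayley (h0 : G 0 = 1) (hre : ∀ x ∈ ball (0 : ℂ) s, 0 ≤ (G x).re) :
    MapsTo (fun x => (G x - 1) / (G x + 1)) (ball 0 s)
      (closedBall ((fun x => (G x - 1) / (G x + 1)) 0) 1) := fun x hx => by
  simpa [h0] using norm_cayley_le_one (hre x hx)

/-- **Harnack's inequality** for the real part of an analytic function. -/
theorem le_re_of_re_nonneg (hG : DifferentiableOn ℂ G (ball 0 s)) (h0 : G 0 = 1)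
    (hre : ∀ x ∈ ball (0 : ℂ) s, 0 ≤ (G x).re) {x : ℂ} (hx : x ∈ ball (0 : ℂ) s) :
    (s - ‖x‖) / (s + ‖x‖) ≤ (G x).re := by
  have hxs : ‖x‖ < s := by simpa using hx
  have hs : 0 < s := (norm_nonneg x).trans_lt hxs
  have hschwarz := Complex.dist_le_div_mul_dist_of_mapsTo_ball
    (differentiableOn_cayley hG hre) (mapsTo_cayley h0 hre) hx
  simp only [h0, sub_self, zero_div, dist_zero_right, one_div_mul_eq_div] at hschwarz
  convert le_re_of_norm_cayley_le (hre x hx) ((div_le_one hs).2 hxs.le) hschwarz using 1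
  field_simp

theorem norm_deriv_zero_le_two (hG : DifferentiableOn ℂ G (ball 0 1)) (h0 : G 0 = 1)
    (hre : ∀ x ∈ ball (0 : ℂ) 1, 0 ≤ (G x).re) : ‖deriv G 0‖ ≤ 2 := by
  have hd : HasDerivAt G (deriv G 0) 0 :=
    (hG.differentiableAt (ball_mem_nhds 0 one_pos)).hasDerivAt
  have hcayley : HasDerivAt (fun x => (G x - 1) / (G x + 1)) (deriv G 0 / 2) 0 := by
    convert! (hd.sub_const 1).div (hd.add_const 1) (by rw [h0]; norm_num) using 1
    rw [h0]
    ring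
  have hschwarz := Complex.norm_deriv_le_div_of_mapsTo_ball
    (differentiableOn_cayley hG hre) (mapsTo_cayley h0 hre) one_pos
  rw [hcayley.deriv, norm_div, Complex.norm_two] at hschwarz
  linarith

/-- **Carathéodory's coefficient bound.** Averaging `F` over the `n`-th roots of unity reduces it to
the first coefficient. -/
theorem HasDiskSeries.norm_coeff_le_two {F : ℂ → ℂ} {c : ℕ → ℂ} (hF : HasDiskSeries F c)
    (h0 : F 0 = 1) (hre : ∀ x ∈ ball (0 : ℂ) 1, 0 ≤ (F x).re) {n : ℕ} (hn : n ≠ 0) :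
    ‖c n‖ ≤ 2 := by
  have : NeZero n := ⟨hn⟩
  obtain ⟨ζ, hζ⟩ : ∃ ζ : ℂ, IsPrimitiveRoot ζ n := ⟨_, Complex.isPrimitiveRoot_exp n hn⟩
  set G : ℂ → ℂ := fun y => ∑' i, c (i * n) * y ^ i
  have hGF {x : ℂ} (hx : x ∈ ball (0 : ℂ) 1) :
      G (x ^ n) = (n : ℂ)⁻¹ * ∑ j ∈ Finset.range n, F (ζ ^ j * x) :=
    (hF.hasSum_coeff_mul hζ hx).tsum_eq
  have hseries : HasDiskSeries G fun i => c (i * n) := fun y hy => by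
    obtain ⟨x, hx, rfl⟩ := exists_pow_eq_mem_ball n hy
    exact (hF.hasSum_coeff_mul hζ hx).summable.hasSum
  have hG0 : G 0 = 1 := by rw [hseries.apply_zero, zero_mul, ← hF.apply_zero, h0]
  have hGre : ∀ y ∈ ball (0 : ℂ) 1, 0 ≤ (G y).re := fun y hy => by
    obtain ⟨x, hx, rfl⟩ := exists_pow_eq_mem_ball n hy
    rw [hGF hx, ← Complex.ofReal_natCast, ← Complex.ofReal_inv, Complex.re_ofReal_mul,
      Complex.re_sum]
    refine mul_nonneg (by positivity) (Finset.sum_nonneg fun j _ => hre _ ?_)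
    simpa [hζ.norm'_eq_one hn] using hx
  simpa [hseries.deriv_zero] using norm_deriv_zero_le_two hseries.differentiableOn hG0 hGre

end PositiveRealPart

/-! ### Jack's lemma -/

section JackLemma

variable {H : ℂ → ℂ} {z : ℂ}

theorem hasDerivAt_re_comp_ray {t : ℝ} (hH : DifferentiableAt ℂ H (t * z)) :
    HasDerivAt (fun t : ℝ => (H (t * z)).re) (z * deriv H (t * z)).re t := by
  rw [mul_comm]
  exact (hH.hasDerivAt.comp (t : ℂ) (hasDerivAt_mul_const z)).real_of_complex

theorem im_mul_deriv_eq_zero_of_isMinOn (hH : DifferentiableAt ℂ H z)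
    (hmin : IsMinOn (fun y => (H y).re) (sphere 0 ‖z‖) z) : (z * deriv H z).im = 0 := by
  have hrot : HasDerivAt (fun t : ℂ => z * Complex.exp (t * Complex.I)) (z * Complex.I)
      ((0 : ℝ) : ℂ) := by
    simpa using ((hasDerivAt_mul_const (x := ((0 : ℝ) : ℂ)) Complex.I).cexp).const_mul z
  have hcomp : HasDerivAt (fun t : ℂ => H (z * Complex.exp (t * Complex.I)))
      (deriv H z * (z * Complex.I)) ((0 : ℝ) : ℂ) :=
    HasDerivAt.comp ((0 : ℝ) : ℂ) (h₂ := H) (by simpa using hH.hasDerivAt) hrot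
  have hlocal : IsLocalMin (fun t : ℝ => (H (z * Complex.exp (t * Complex.I))).re) 0 := by
    refine Eventually.of_forall fun t => ?_
    simp only [Complex.ofReal_zero, zero_mul, Complex.exp_zero, mul_one]
    exact hmin (by simp [Complex.norm_exp_ofReal_mul_I])
  have hzero := hlocal.hasDerivAt_eq_zero hcomp.real_of_complex
  rwa [← mul_assoc, Complex.mul_I_re, mul_comm, neg_eq_zero] at hzero

theorem two_mul_div_le_re_of_isMinOn (hH : DifferentiableOn ℂ H (ball 0 ‖z‖)) (h0 : H 0 = 0)
    (hmin : IsMinOn (fun y => (H y).re) (closedBall 0 ‖z‖) z) (hneg : (H z).re < 0) {t : ℝ}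
    (ht : t ∈ Icc (0 : ℝ) 1) : (H z).re * (2 * t / (1 + t)) ≤ (H (t * z)).re := by
  set c := (H z).re with hc
  rcases ht.2.eq_or_lt with rfl | ht1
  · norm_num [← hc]
  have hz : 0 < ‖z‖ := norm_pos_iff.2 fun hz => by simp [hc, hz, h0] at hneg
  have hnorm : ‖(t : ℂ) * z‖ = t * ‖z‖ := by
    rw [norm_mul, Complex.norm_real, Real.norm_of_nonneg ht.1]
  have hre (y : ℂ) : (((-c)⁻¹ : ℝ) * H y + 1).re = (-c)⁻¹ * (H y).re + 1 := by
    simp only [Complex.add_re, Complex.re_ofReal_mul, Complex.one_re]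
  have hharnack := le_re_of_re_nonneg (G := fun y => ((-c)⁻¹ : ℝ) * H y + 1)
    ((hH.const_mul _).add_const 1) (by simp [h0])
    (fun y hy => by
      have hy_min : c ≤ (H y).re := hmin (ball_subset_closedBall hy)
      rw [hre, ← neg_le_iff_add_nonneg, inv_mul_eq_div, le_div_iff₀ (neg_pos.2 hneg)]
      linarith)
    (x := t * z) (by rw [mem_ball_zero_iff, hnorm]; exact mul_lt_of_lt_one_left hz ht1)
  have hratio : (‖z‖ - t * ‖z‖) / (‖z‖ + t * ‖z‖) = 1 - 2 * t / (1 + t) := by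
    have := ht.1
    field_simp
    ring
  rw [hre, hnorm, hratio, ← sub_le_iff_le_add, inv_mul_eq_div,
    le_div_iff₀ (neg_pos.2 hneg)] at hharnack
  linarith

/-- **Jack's lemma** for the real part, in the sharp form provided by Harnack's inequality. -/
theorem re_mul_deriv_le_half_of_isMinOn (hH : DifferentiableOn ℂ H (ball 0 ‖z‖))
    (hz : DifferentiableAt ℂ H z) (h0 : H 0 = 0)
    (hmin : IsMinOn (fun y => (H y).re) (closedBall 0 ‖z‖) z) (hneg : (H z).re < 0) :
    (z * deriv H z).re ≤ (H z).re / 2 := by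
  set c := (H z).re
  have hquot : HasDerivAt (fun t : ℝ => 2 * t / (1 + t)) (1 / 2) 1 := by
    convert! ((hasDerivAt_id (1 : ℝ)).const_mul 2).div ((hasDerivAt_id (1 : ℝ)).const_add 1)
      (by norm_num) using 1
    norm_num
  have hray : HasDerivAt (fun t : ℝ => (H (t * z)).re) (z * deriv H z).re 1 := by
    simpa using hasDerivAt_re_comp_ray (H := H) (z := z) (t := 1) (by simpa using hz)
  have hdiff := hray.sub (hquot.const_mul c)
  have hlocal : IsMinOn (fun t : ℝ => (H (t * z)).re - c * (2 * t / (1 + t))) (Icc 0 1) 1 :=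
    fun t ht => by
      have := two_mul_div_le_re_of_isMinOn hH h0 hmin hneg ht
      simp only [mem_ofPred_eq, Complex.ofReal_one, one_mul]
      norm_num
      linarith
  have hnonneg := hlocal.localize.hasFDerivWithinAt_nonneg hdiff.hasFDerivAt.hasFDerivWithinAt
    (sub_mem_posTangentConeAt_of_segment_subset (y := 0) (by
      rw [segment_symm, segment_eq_Icc zero_le_one]))
  simp only [zero_sub, map_neg, ContinuousLinearMap.toSpanSingleton_apply, one_smul,
    Left.nonneg_neg_iff] at hnonneg
  linarith

theorem neg_two_lt_re_of_one_add_mul_deriv_mem_slitPlane (hH : DifferentiableOn ℂ H (ball 0 1))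
    (h0 : H 0 = 0) (hslit : ∀ y ∈ ball (0 : ℂ) 1, 1 + y * deriv H y ∈ Complex.slitPlane) {x : ℂ}
    (hx : x ∈ ball (0 : ℂ) 1) : -2 < (H x).re := by
  have hsub : closedBall (0 : ℂ) ‖x‖ ⊆ ball 0 1 := closedBall_subset_ball (by simpa using hx)
  obtain ⟨z, hz, hmin⟩ := (isCompact_closedBall (0 : ℂ) ‖x‖).exists_isMinOn ⟨x, by simp⟩
    (Complex.continuous_re.comp_continuousOn (hH.continuousOn.mono hsub))
  by_contra! hle
  have hneg : (H z).re ≤ -2 := (isMinOn_iff.1 hmin x (by simp)).trans hle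
  have hzx : closedBall (0 : ℂ) ‖z‖ ⊆ closedBall 0 ‖x‖ :=
    closedBall_subset_closedBall (by simpa using hz)
  have hHz : DifferentiableAt ℂ H z := hH.differentiableAt (isOpen_ball.mem_nhds (hsub hz))
  have him := im_mul_deriv_eq_zero_of_isMinOn hHz
    (hmin.on_subset (sphere_subset_closedBall.trans hzx))
  have hre := re_mul_deriv_le_half_of_isMinOn
    (hH.mono (ball_subset_closedBall.trans (hzx.trans hsub))) hHz h0
    (hmin.on_subset hzx) (by linarith)
  rcases Complex.mem_slitPlane_iff.1 (hslit z (hsub hz)) with h | h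
  · rw [Complex.add_re, Complex.one_re] at h
    linarith
  · exact h (by simp [him])

end JackLemma

theorem mul_mem_slitPlane_of_re_pos {p q : ℂ} (hp : 0 < p.re) (hq : 0 < q.re) :
    p * q ∈ Complex.slitPlane := by
  rw [Complex.mem_slitPlane_iff, Complex.mul_re, Complex.mul_im]
  by_contra! h
  have hpos : 0 < (p.re * p.re + p.im * p.im) * q.re :=
    mul_pos (by nlinarith [mul_self_nonneg p.im, mul_pos hp hp]) hq
  nlinarith [mul_nonneg hp.le (sub_nonneg.2 h.1), congrArg (p.im * ·) h.2]

theorem exists_mul_deriv_eq_sub {q : ℂ → ℂ} (hq : DifferentiableOn ℂ q (ball 0 1)) :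
    ∃ K : ℂ → ℂ, DifferentiableOn ℂ K (ball 0 1) ∧ K 0 = 0 ∧
      ∀ y ∈ ball (0 : ℂ) 1, y * deriv K y = q y - q 0 := by
  have hslope : DifferentiableOn ℂ (dslope q 0) (ball 0 1) :=
    (Complex.differentiableOn_dslope (ball_mem_nhds 0 one_pos)).2 hq
  obtain ⟨K, hK0, hK⟩ := hslope.isExactOn_ball.with_val_at 0 0
  refine ⟨K, fun y hy => (hK y hy).differentiableAt.differentiableWithinAt, hK0, fun y hy => ?_⟩
  rw [(hK y hy).deriv]
  simpa using sub_smul_dslope q 0 y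

theorem neg_two_mul_log_le_re {K : ℂ → ℂ} (hK : DifferentiableOn ℂ K (ball 0 1)) (h0 : K 0 = 0)
    (hre : ∀ y ∈ ball (0 : ℂ) 1, 0 ≤ (1 + y * deriv K y).re) {x : ℂ} (hx : x ∈ ball (0 : ℂ) 1) :
    -(2 * Real.log (1 + ‖x‖)) ≤ (K x).re := by
  have hmem {t : ℝ} (ht : t ∈ Icc (0 : ℝ) 1) : (t : ℂ) * x ∈ ball (0 : ℂ) 1 := by
    rw [mem_ball_zero_iff, norm_mul, Complex.norm_real, Real.norm_of_nonneg ht.1]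
    exact (mul_le_of_le_one_left (norm_nonneg x) ht.2).trans_lt (by simpa using hx)
  have hpos {t : ℝ} (ht : 0 ≤ t) : 0 < 1 + t * ‖x‖ := by positivity
  have hderiv {t : ℝ} (ht : t ∈ Icc (0 : ℝ) 1) : HasDerivAt
      (fun t : ℝ => (K (t * x)).re + 2 * Real.log (1 + t * ‖x‖))
      ((x * deriv K (t * x)).re + 2 * (‖x‖ / (1 + t * ‖x‖))) t :=
    (hasDerivAt_re_comp_ray (hK.differentiableAt (isOpen_ball.mem_nhds (hmem ht)))).add
      ((((hasDerivAt_mul_const ‖x‖).const_add 1).log (hpos ht.1).ne').const_mul 2)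
  have hmono : MonotoneOn (fun t : ℝ => (K (t * x)).re + 2 * Real.log (1 + t * ‖x‖))
      (Icc 0 1) := by
    refine monotoneOn_of_hasDerivWithinAt_nonneg (convex_Icc 0 1)
      (fun t ht => (hderiv ht).continuousAt.continuousWithinAt)
      (fun t ht => (hderiv (interior_subset ht)).hasDerivWithinAt) fun t ht => ?_
    rw [interior_Icc] at ht
    have hharnack := le_re_of_re_nonneg (G := fun y => 1 + y * deriv K y)
      ((differentiableOn_id.mul (hK.deriv isOpen_ball)).const_add 1) (by simp) hre
      (hmem (Ioo_subset_Icc_self ht))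
    rw [norm_mul, Complex.norm_real, Real.norm_of_nonneg ht.1.le, Complex.add_re, Complex.one_re,
      mul_assoc, Complex.re_ofReal_mul, div_le_iff₀ (hpos ht.1.le)] at hharnack
    rw [← mul_div_assoc, ← sub_neg_eq_add, sub_nonneg, ← neg_div, div_le_iff₀ (hpos ht.1.le)]
    nlinarith [ht.1]
  simpa [h0, ← sub_eq_add_neg, neg_le_iff_add_nonneg] using
    hmono (left_mem_Icc.2 zero_le_one) (right_mem_Icc.2 zero_le_one) zero_le_one

/-! ### Carathéodory functions -/

theorem norm_sum_antidiagonal_mul_le {R : Type*} [SeminormedRing R] {c d : ℕ → R} {M : ℝ}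
    (hc0 : ‖c 0‖ ≤ 1) (hc : ∀ i, ‖c (i + 1)‖ ≤ M) (hd : ∀ j, ‖d j‖ ≤ 1) (n : ℕ) :
    ‖∑ ij ∈ antidiagonal n, c ij.1 * d ij.2‖ ≤ 1 + n * M := by
  have hM : 0 ≤ M := (norm_nonneg _).trans (hc 0)
  have hterm {A : ℝ} {i j : ℕ} (hA : 0 ≤ A) (hi : ‖c i‖ ≤ A) : ‖c i * d j‖ ≤ A :=
    (norm_mul_le _ _).trans ((mul_le_mul hi (hd j) (norm_nonneg _) hA).trans_eq (mul_one A))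
  rw [Finset.Nat.sum_antidiagonal_eq_sum_range_succ (fun i j => c i * d j), Finset.sum_range_succ',
    add_comm]
  refine (norm_add_le _ _).trans (add_le_add (hterm zero_le_one hc0) ?_)
  simpa using norm_sum_le_of_le (Finset.range n) fun i _ => hterm hM (hc i)

/-- `p` is an analytic function on the unit disk with `p(0) = 1` and `Re p > α`: a Carathéodory
function of order `α`. -/
structure IsCaratheodory (α : ℝ) (p : ℂ → ℂ) : Prop where
  differentiableOn : DifferentiableOn ℂ p (ball 0 1)
  apply_zero : p 0 = 1
  lt_re : ∀ x ∈ ball (0 : ℂ) 1, α < (p x).re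

namespace IsCaratheodory

variable {α : ℝ} {p q : ℂ → ℂ}

theorem order_lt_one (hp : IsCaratheodory α p) : α < 1 := by
  simpa [hp.apply_zero] using hp.lt_re 0 (by simp)

theorem re_pos (hp : IsCaratheodory 0 p) {x : ℂ} (hx : x ∈ ball (0 : ℂ) 1) : 0 < (p x).re :=
  hp.lt_re x hx

theorem normalize (hp : IsCaratheodory α p) :
    IsCaratheodory 0 fun x => (1 - α : ℂ)⁻¹ * (p x + -α) := by
  have hα : 0 < 1 - α := sub_pos.2 hp.order_lt_one
  refine ⟨(hp.differentiableOn.add_const _).const_mul _, ?_, fun x hx => ?_⟩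
  · rw [hp.apply_zero, ← sub_eq_add_neg]
    exact inv_mul_cancel₀ (by exact_mod_cast hα.ne')
  · have hcast : ((1 : ℂ) - α)⁻¹ = ((1 - α)⁻¹ : ℝ) := by push_cast; rfl
    rw [hcast, Complex.re_ofReal_mul, ← Complex.ofReal_neg, Complex.add_re, Complex.ofReal_re]
    exact mul_pos (inv_pos.2 hα) (by linarith [hp.lt_re x hx])

theorem norm_coeff_le (hp : IsCaratheodory α p) {c : ℕ → ℂ} (hc : HasDiskSeries p c) {n : ℕ}
    (hn : n ≠ 0) : ‖c n‖ ≤ 2 * (1 - α) := by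
  have hα : 0 < 1 - α := sub_pos.2 hp.order_lt_one
  have hcast : ((1 : ℂ) - α)⁻¹ = ((1 - α)⁻¹ : ℝ) := by push_cast; rfl
  have h := ((hc.add (.const _)).const_mul _).norm_coeff_le_two hp.normalize.apply_zero
    (fun x hx => (hp.normalize.re_pos hx).le) hn
  rwa [Pi.single_eq_of_ne hn, add_zero, hcast, norm_mul, Complex.norm_real,
    Real.norm_of_nonneg (inv_pos.2 hα).le, inv_mul_le_iff₀ hα, mul_comm] at h

/-- With `x K' = q - 1`, the function `L = (H - α K) / (1 - α)` satisfies
`1 + x L' = q (p - α) / (1 - α)`, so that Jack's lemma applies to `L` and the logarithmic bound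
to `K`. -/
theorem neg_le_re_of_mul_deriv_eq (hp : IsCaratheodory α p) (hq : IsCaratheodory 0 q)
    (hα : 0 ≤ α) {H : ℂ → ℂ} (hH : DifferentiableOn ℂ H (ball 0 1)) (h0 : H 0 = 0)
    (hpq : ∀ y ∈ ball (0 : ℂ) 1, 1 + y * deriv H y = p y * q y) {x : ℂ}
    (hx : x ∈ ball (0 : ℂ) 1) : -(2 * α * Real.log 2) - 2 * (1 - α) ≤ (H x).re := by
  have hα1 : 0 < 1 - α := sub_pos.2 hp.order_lt_one
  have hcast : ((1 : ℂ) - α)⁻¹ = ((1 - α)⁻¹ : ℝ) := by push_cast; rfl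
  have hα' : (1 - α : ℂ) ≠ 0 := by exact_mod_cast hα1.ne'
  obtain ⟨K, hK, hK0, hKq⟩ := exists_mul_deriv_eq_sub hq.differentiableOn
  have hL : DifferentiableOn ℂ (fun y => (1 - α : ℂ)⁻¹ * (H y - α * K y)) (ball 0 1) :=
    (hH.sub (hK.const_mul _)).const_mul _
  have hK_re : -(2 * Real.log (1 + ‖x‖)) ≤ (K x).re :=
    neg_two_mul_log_le_re hK hK0 (fun y hy => by
      rw [hKq y hy, hq.apply_zero, add_sub_cancel]
      exact (hq.re_pos hy).le) hx
  have hL_re : -2 < ((1 - α : ℂ)⁻¹ * (H x - α * K x)).re := by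
    refine neg_two_lt_re_of_one_add_mul_deriv_mem_slitPlane hL (by simp [h0, hK0])
      (fun y hy => ?_) hx
    convert mul_mem_slitPlane_of_re_pos (hp.normalize.re_pos hy) (hq.re_pos hy) using 1
    have hHy := hH.differentiableAt (isOpen_ball.mem_nhds hy)
    have hKy := hK.differentiableAt (isOpen_ball.mem_nhds hy)
    rw [deriv_const_mul_field, deriv_fun_sub hHy (hKy.const_mul _), deriv_const_mul_field]
    have hKq_y := hKq y hy
    rw [hq.apply_zero] at hKq_y
    field_simp
    linear_combination hpq y hy - α * hKq_y
  rw [hcast, Complex.re_ofReal_mul, Complex.sub_re, Complex.re_ofReal_mul, inv_mul_eq_div,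
    lt_div_iff₀ hα1] at hL_re
  have hlog : Real.log (1 + ‖x‖) ≤ Real.log 2 :=
    Real.log_le_log (by positivity) (by linarith [mem_ball_zero_iff.1 hx])
  nlinarith [mul_le_mul_of_nonneg_left hlog hα, mul_le_mul_of_nonneg_left hK_re hα]

theorem norm_half_coeff_add_le {c : ℕ → ℂ} (hq : IsCaratheodory 0 q)
    (hc : HasDiskSeries q c) {e : ℂ} (he : ‖1 + e‖ ≤ 2) (n : ℕ) :
    ‖2⁻¹ * (c n + (Pi.single 0 e : ℕ → ℂ) n)‖ ≤ 1 := by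
  rw [norm_mul, norm_inv, Complex.norm_two, inv_mul_le_iff₀ two_pos, mul_one]
  rcases eq_or_ne n 0 with rfl | hn
  · simpa [← hc.apply_zero, hq.apply_zero] using he
  · simpa [hn] using hq.norm_coeff_le hc hn

theorem norm_coeff_mul_add_one_le (hp : IsCaratheodory α p) (hq : IsCaratheodory 0 q) {u : ℕ → ℂ}
    (hu : HasDiskSeries (fun x => p x * (2⁻¹ * (q x + 1))) u) (n : ℕ) :
    ‖u n‖ ≤ 1 + n * (2 * (1 - α)) := by
  obtain ⟨c, hc⟩ : ∃ c, HasDiskSeries p c := ⟨_, .taylor hp.differentiableOn⟩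
  obtain ⟨d, hd⟩ : ∃ d, HasDiskSeries q d := ⟨_, .taylor hq.differentiableOn⟩
  rw [hu.unique (hc.mul ((hd.add (.const 1)).const_mul 2⁻¹))]
  exact norm_sum_antidiagonal_mul_le (by rw [← hc.apply_zero, hp.apply_zero, norm_one])
    (fun i => hp.norm_coeff_le hc i.succ_ne_zero) (hq.norm_half_coeff_add_le hd (by norm_num)) n

theorem norm_coeff_succ_mul_sub_one_le (hp : IsCaratheodory α p) (hq : IsCaratheodory 0 q)
    {u : ℕ → ℂ} (hu : HasDiskSeries (fun x => p x * (2⁻¹ * (q x + -1))) u) (n : ℕ) :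
    ‖u (n + 1)‖ ≤ 1 + n * (2 * (1 - α)) := by
  obtain ⟨c, hc⟩ : ∃ c, HasDiskSeries p c := ⟨_, .taylor hp.differentiableOn⟩
  obtain ⟨d, hd⟩ : ∃ d, HasDiskSeries q d := ⟨_, .taylor hq.differentiableOn⟩
  rw [hu.unique (hc.mul ((hd.add (.const (-1))).const_mul 2⁻¹))]
  simp only [Finset.Nat.sum_antidiagonal_succ', Pi.single_eq_same, ← hd.apply_zero,
    hq.apply_zero, add_neg_cancel, mul_zero, zero_add]
  exact norm_sum_antidiagonal_mul_le (by rw [← hc.apply_zero, hp.apply_zero, norm_one])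
    (fun i => hp.norm_coeff_le hc i.succ_ne_zero)
    (fun j => hq.norm_half_coeff_add_le hd (by norm_num) (j + 1)) n

end IsCaratheodory

/-! ### Logharmonic mappings -/

/-- The real-linear map `v ↦ a v + b v̄`: the differential of a function with Wirtinger derivatives
`a` and `b`. -/
noncomputable def wirtingerMap (a b : ℂ) : ℂ →L[ℝ] ℂ :=
  a • ContinuousLinearMap.id ℝ ℂ + b • (Complex.conjCLE : ℂ ≃L[ℝ] ℂ).toContinuousLinearMap

section Wirtinger

variable {f g F G : ℂ → ℂ} {a b z F' G' : ℂ}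

theorem wirtingerMap_apply (a b v : ℂ) : wirtingerMap a b v = a * v + b * conj v := by
  simp [wirtingerMap]

theorem wirtingerZ_eq_of_hasFDerivAt (h : HasFDerivAt f (wirtingerMap a b) z) :
    wirtingerZ f z = a := by
  rw [wirtingerZ, h.fderiv, wirtingerMap_apply, wirtingerMap_apply]
  simp only [map_one, Complex.conj_I]
  linear_combination (-(a - b) / 2) * Complex.I_mul_I

theorem wirtingerZbar_eq_of_hasFDerivAt (h : HasFDerivAt f (wirtingerMap a b) z) :
    wirtingerZbar f z = b := by
  rw [wirtingerZbar, h.fderiv, wirtingerMap_apply, wirtingerMap_apply]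
  simp only [map_one, Complex.conj_I]
  linear_combination ((a - b) / 2) * Complex.I_mul_I

theorem wirtingerZ_congr (h : f =ᶠ[𝓝 z] g) : wirtingerZ f z = wirtingerZ g z := by
  rw [wirtingerZ, wirtingerZ, h.fderiv_eq]

theorem wirtingerZbar_congr (h : f =ᶠ[𝓝 z] g) : wirtingerZbar f z = wirtingerZbar g z := by
  rw [wirtingerZbar, wirtingerZbar, h.fderiv_eq]

theorem range_wirtingerMap_eq_top (hab : ‖b‖ < ‖a‖) : (wirtingerMap a b).range = ⊤ := by
  rw [LinearMap.range_eq_top, ← LinearMap.injective_iff_surjective, injective_iff_map_eq_zero]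
  intro v hv
  have hv : a * v + b * conj v = 0 := (wirtingerMap_apply a b v).symm.trans hv
  by_contra hv0
  have hnorm : ‖a‖ * ‖v‖ = ‖b‖ * ‖v‖ := by
    rw [← norm_mul, eq_neg_of_add_eq_zero_left hv, norm_neg, norm_mul, RCLike.norm_conj]
  exact hab.ne' (mul_right_cancel₀ (norm_ne_zero_iff.2 hv0) hnorm)

theorem hasStrictFDerivAt_mul_conj (hF : HasStrictDerivAt F F' z) (hG : HasStrictDerivAt G G' z) :
    HasStrictFDerivAt (fun w => F w * conj (G w))
      (wirtingerMap (F' * conj (G z)) (F z * conj G')) z := by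
  have hconj := (Complex.conjCLE : ℂ ≃L[ℝ] ℂ).toContinuousLinearMap.hasStrictFDerivAt.comp z
    (hG.hasStrictFDerivAt.restrictScalars ℝ)
  refine ((hF.hasStrictFDerivAt.restrictScalars ℝ).mul hconj).congr_fderiv ?_
  ext v
  simp [wirtingerMap]
  ring

end Wirtinger

/-- The operator `z d/dz` applied to `z ↦ A (z ^ k)`, as a function of `x = z ^ k`. -/
noncomputable def eulerDeriv (k : ℕ) (A : ℂ → ℂ) (x : ℂ) : ℂ :=
  k * (x * deriv A x)

/-- The mapping `z h(z) conj(g(z))` with `h = exp A(z ^ k)` and `g = exp B(z ^ k)`. -/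
noncomputable def logharmonicMap (k : ℕ) (A B : ℂ → ℂ) (z : ℂ) : ℂ :=
  z * Complex.exp (A (z ^ k)) * conj (Complex.exp (B (z ^ k)))

section LogharmonicMap

variable {k : ℕ} {A B : ℂ → ℂ} {z : ℂ}

theorem logharmonicMap_zero : logharmonicMap k A B 0 = 0 := by
  simp [logharmonicMap]

theorem logharmonicMap_ne_zero (hz : z ≠ 0) : logharmonicMap k A B z ≠ 0 :=
  mul_ne_zero (mul_ne_zero hz (Complex.exp_ne_zero _))
    ((map_ne_zero _).2 (Complex.exp_ne_zero _))

theorem norm_logharmonicMap :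
    ‖logharmonicMap k A B z‖ = ‖z‖ * Real.exp ((A (z ^ k)).re + (B (z ^ k)).re) := by
  rw [logharmonicMap, norm_mul, norm_mul, RCLike.norm_conj, Complex.norm_exp, Complex.norm_exp,
    Real.exp_add, mul_assoc]

variable [NeZero k]

theorem isKFoldSymmetric_logharmonicMap : IsKFoldSymmetric k (logharmonicMap k A B) := by
  intro z _
  have hroot : Complex.exp (2 * Real.pi * Complex.I / k) ^ k = 1 := by
    rw [← Complex.exp_nat_mul, mul_div_cancel₀ _ (NeZero.ne (k : ℂ)), Complex.exp_two_pi_mul_I]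
  rw [logharmonicMap, logharmonicMap, mul_pow, hroot, one_mul]
  ring

theorem hasStrictDerivAt_exp_comp_pow (hA : DifferentiableOn ℂ A (ball 0 1))
    (hz : z ∈ ball (0 : ℂ) 1) :
    HasStrictDerivAt (fun w => Complex.exp (A (w ^ k)))
      (Complex.exp (A (z ^ k)) * (deriv A (z ^ k) * (k * z ^ (k - 1)))) z :=
  ((hA.analyticAt (isOpen_ball.mem_nhds (pow_mem_ball_zero_one_iff.2 hz))).hasStrictDerivAt.comp z
    (hasStrictDerivAt_pow k z)).cexp

theorem hasStrictFDerivAt_logharmonicMap (hA : DifferentiableOn ℂ A (ball 0 1))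
    (hB : DifferentiableOn ℂ B (ball 0 1)) (hz : z ∈ ball (0 : ℂ) 1) :
    HasStrictFDerivAt (logharmonicMap k A B) (wirtingerMap
      (Complex.exp (A (z ^ k)) * conj (Complex.exp (B (z ^ k))) * (1 + eulerDeriv k A (z ^ k)))
      (z * Complex.exp (A (z ^ k)) * conj (Complex.exp (B (z ^ k)) *
        (deriv B (z ^ k) * (k * z ^ (k - 1)))))) z := by
  refine (hasStrictFDerivAt_mul_conj
    ((hasStrictDerivAt_id z).mul (hasStrictDerivAt_exp_comp_pow hA hz))
    (hasStrictDerivAt_exp_comp_pow hB hz)).congr_fderiv ?_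
  congr 1
  rw [eulerDeriv, id, ← mul_pow_sub_one (NeZero.ne k) z]
  ring

theorem mul_wirtingerZ_logharmonicMap (hA : DifferentiableOn ℂ A (ball 0 1))
    (hB : DifferentiableOn ℂ B (ball 0 1)) (hz : z ∈ ball (0 : ℂ) 1) :
    z * wirtingerZ (logharmonicMap k A B) z =
      logharmonicMap k A B z * (1 + eulerDeriv k A (z ^ k)) := by
  rw [wirtingerZ_eq_of_hasFDerivAt (hasStrictFDerivAt_logharmonicMap hA hB hz).hasFDerivAt,
    logharmonicMap]
  ring

theorem conj_mul_wirtingerZbar_logharmonicMap (hA : DifferentiableOn ℂ A (ball 0 1))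
    (hB : DifferentiableOn ℂ B (ball 0 1)) (hz : z ∈ ball (0 : ℂ) 1) :
    conj z * wirtingerZbar (logharmonicMap k A B) z =
      logharmonicMap k A B z * conj (eulerDeriv k B (z ^ k)) := by
  rw [wirtingerZbar_eq_of_hasFDerivAt (hasStrictFDerivAt_logharmonicMap hA hB hz).hasFDerivAt,
    logharmonicMap, eulerDeriv, ← mul_pow_sub_one (NeZero.ne k) z]
  simp only [map_mul, map_natCast]
  ring

theorem logharmonic_equation_iff (hA : DifferentiableOn ℂ A (ball 0 1))
    (hB : DifferentiableOn ℂ B (ball 0 1)) (hz : z ∈ ball (0 : ℂ) 1) (hz0 : z ≠ 0) (w : ℂ) :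
    conj (wirtingerZbar (logharmonicMap k A B) z) * logharmonicMap k A B z =
        w * wirtingerZ (logharmonicMap k A B) z * conj (logharmonicMap k A B z) ↔
      eulerDeriv k B (z ^ k) = w * (1 + eulerDeriv k A (z ^ k)) := by
  have hZ := mul_wirtingerZ_logharmonicMap (k := k) hA hB hz
  have hZbar := congrArg conj (conj_mul_wirtingerZbar_logharmonicMap (k := k) hA hB hz)
  simp only [map_mul, Complex.conj_conj] at hZbar
  have hf : logharmonicMap k A B z ≠ 0 := logharmonicMap_ne_zero hz0
  have hfc : conj (logharmonicMap k A B z) ≠ 0 := (map_ne_zero _).2 hf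
  refine ⟨fun h => mul_left_cancel₀ (mul_ne_zero hfc hf) ?_, fun h => mul_left_cancel₀ hz0 ?_⟩
  · linear_combination z * h + (w * conj (logharmonicMap k A B z)) * hZ -
      logharmonicMap k A B z * hZbar
  · linear_combination (logharmonicMap k A B z * conj (logharmonicMap k A B z)) * h +
      logharmonicMap k A B z * hZbar - (w * conj (logharmonicMap k A B z)) * hZ

theorem re_starlike_quotient_eq (hA : DifferentiableOn ℂ A (ball 0 1))
    (hB : DifferentiableOn ℂ B (ball 0 1)) (hz : z ∈ ball (0 : ℂ) 1) (hz0 : z ≠ 0) :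
    ((z * wirtingerZ (logharmonicMap k A B) z - conj z * wirtingerZbar (logharmonicMap k A B) z) /
        logharmonicMap k A B z).re =
      (1 + eulerDeriv k A (z ^ k) - eulerDeriv k B (z ^ k)).re := by
  rw [mul_wirtingerZ_logharmonicMap hA hB hz, conj_mul_wirtingerZbar_logharmonicMap hA hB hz,
    ← mul_sub, mul_div_cancel_left₀ _ (logharmonicMap_ne_zero hz0), Complex.sub_re,
    Complex.conj_re, ← Complex.sub_re]

end LogharmonicMap

theorem eulerDeriv_zero (k : ℕ) (A : ℂ → ℂ) : eulerDeriv k A 0 = 0 := by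
  rw [eulerDeriv, zero_mul, mul_zero]

theorem differentiableOn_eulerDeriv (k : ℕ) {A : ℂ → ℂ} (hA : DifferentiableOn ℂ A (ball 0 1)) :
    DifferentiableOn ℂ (eulerDeriv k A) (ball 0 1) :=
  (differentiableOn_id.mul (hA.deriv isOpen_ball)).const_mul _

theorem differentiableOn_comp_pow {k : ℕ} [NeZero k] {A : ℂ → ℂ}
    (hA : DifferentiableOn ℂ A (ball 0 1)) :
    DifferentiableOn ℂ (fun z => A (z ^ k)) (ball 0 1) :=
  hA.comp (differentiable_pow k).differentiableOn fun _ hz => pow_mem_ball_zero_one_iff.2 hz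

theorem HasDiskSeries.eulerDeriv {F : ℂ → ℂ} {c : ℕ → ℂ} (hF : HasDiskSeries F c) (k : ℕ) :
    HasDiskSeries (eulerDeriv k F) (fun n => k * (n * c n)) :=
  hF.mul_deriv.const_mul _

theorem IsExpSeries.exists_hasDiskSeries {k : ℕ} [NeZero k] {c : ℕ → ℂ} {u : ℂ → ℂ}
    (h : IsExpSeries k c u) : ∃ A : ℂ → ℂ,
      HasDiskSeries A (Function.update (fun n => c (n * k)) 0 0) ∧
      ∀ z ∈ ball (0 : ℂ) 1, u z = Complex.exp (A (z ^ k)) := by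
  have hsum : ∀ z ∈ ball (0 : ℂ) 1, ∃ s : ℂ,
      HasSum (fun n => Function.update (fun n => c (n * k)) 0 0 n * (z ^ k) ^ n) s ∧
        u z = Complex.exp s := by
    intro z hz
    obtain ⟨s, hs, hu⟩ := h z hz
    refine ⟨s, ?_, hu⟩
    rw [← hasSum_nat_add_iff' 1]
    simpa [← pow_mul, mul_comm k] using hs
  refine ⟨fun x => ∑' n, Function.update (fun n => c (n * k)) 0 0 n * x ^ n, fun x hx => ?_,
    fun z hz => ?_⟩
  · obtain ⟨z, hz, rfl⟩ := exists_pow_eq_mem_ball k hx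
    obtain ⟨s, hs, -⟩ := hsum z hz
    exact hs.summable.hasSum
  · obtain ⟨s, hs, hu⟩ := hsum z hz
    simp only [hu, hs.tsum_eq]

theorem HasDiskSeries.isExpSeries {k : ℕ} [NeZero k] {c : ℕ → ℂ} {A : ℂ → ℂ}
    (h : HasDiskSeries A c) (h0 : A 0 = 0) :
    IsExpSeries k (fun m => c (m / k)) (fun z => Complex.exp (A (z ^ k))) := by
  intro z hz
  refine ⟨A (z ^ k), ?_, rfl⟩
  have hsum := h (z ^ k) (pow_mem_ball_zero_one_iff.2 hz)
  rw [← hasSum_nat_add_iff' 1] at hsum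
  simpa [← h.apply_zero, h0, ← pow_mul, mul_comm k, NeZero.ne k] using hsum

/-- The exponents `A`, `B` of a logharmonic mapping `logharmonicMap k A B` that is starlike of order
`α`: with `U = 1 + eulerDeriv k A` and `V = eulerDeriv k B` the condition `Re (U - V) > α` is
starlikeness, and `|V| < |U|` says that the second dilatation is bounded by `1`. -/
structure IsStarlikePair (k : ℕ) (α : ℝ) (A B : ℂ → ℂ) : Prop where
  differentiableOn_left : DifferentiableOn ℂ A (ball 0 1)
  differentiableOn_right : DifferentiableOn ℂ B (ball 0 1)
  left_zero : A 0 = 0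
  right_zero : B 0 = 0
  lt_re : ∀ x ∈ ball (0 : ℂ) 1, α < (1 + eulerDeriv k A x - eulerDeriv k B x).re
  norm_lt : ∀ x ∈ ball (0 : ℂ) 1, ‖eulerDeriv k B x‖ < ‖1 + eulerDeriv k A x‖

theorem IsStarlikePair.one_add_eulerDeriv_ne_zero {k : ℕ} {α : ℝ} {A B : ℂ → ℂ}
    (hP : IsStarlikePair k α A B) {x : ℂ} (hx : x ∈ ball (0 : ℂ) 1) : 1 + eulerDeriv k A x ≠ 0 :=
  norm_pos_iff.1 ((norm_nonneg _).trans_lt (hP.norm_lt x hx))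

section IsStarlikePair

variable {k : ℕ} [NeZero k] {α : ℝ} {A B f h g ω : ℂ → ℂ} {a b : ℕ → ℂ}

theorem IsSLHkStar.lt_re_and_norm_lt (hα0 : 0 ≤ α) (hS : IsSLHkStar k α f h g ω a b)
    (hA : DifferentiableOn ℂ A (ball 0 1)) (hB : DifferentiableOn ℂ B (ball 0 1))
    (hf : EqOn f (logharmonicMap k A B) (ball 0 1)) {z : ℂ} (hz : z ∈ ball (0 : ℂ) 1)
    (hz0 : z ≠ 0) :
    α < (1 + eulerDeriv k A (z ^ k) - eulerDeriv k B (z ^ k)).re ∧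
      ‖eulerDeriv k B (z ^ k)‖ < ‖1 + eulerDeriv k A (z ^ k)‖ := by
  have hfz : f =ᶠ[𝓝 z] logharmonicMap k A B := hf.eventuallyEq_of_mem (isOpen_ball.mem_nhds hz)
  have hstar := hS.starlike z hz hz0
  have heq := hS.logharmonic.equation z hz
  rw [wirtingerZ_congr hfz, wirtingerZbar_congr hfz, hf hz] at hstar heq
  rw [re_starlike_quotient_eq hA hB hz hz0] at hstar
  rw [logharmonic_equation_iff hA hB hz hz0] at heq
  refine ⟨hstar, ?_⟩
  have hU : 1 + eulerDeriv k A (z ^ k) ≠ 0 := by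
    intro hU
    rw [heq, hU, mul_zero, sub_zero, Complex.zero_re] at hstar
    exact hstar.not_ge hα0
  rw [heq, norm_mul]
  exact mul_lt_of_lt_one_left (norm_pos_iff.2 hU) (hS.logharmonic.dilatation_lt_one z hz)

theorem IsSLHkStar.exists_isStarlikePair (hα0 : 0 ≤ α) (hα1 : α < 1)
    (hS : IsSLHkStar k α f h g ω a b) :
    ∃ A B : ℂ → ℂ, IsStarlikePair k α A B ∧ EqOn f (logharmonicMap k A B) (ball 0 1) ∧
      HasDiskSeries A (Function.update (fun n => a (n * k)) 0 0) ∧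
      HasDiskSeries B (Function.update (fun n => b (n * k)) 0 0) := by
  obtain ⟨A, hA, hhA⟩ := hS.h_series.exists_hasDiskSeries
  obtain ⟨B, hB, hgB⟩ := hS.g_series.exists_hasDiskSeries
  have hf : EqOn f (logharmonicMap k A B) (ball 0 1) := fun z hz => by
    rw [hS.representation z hz, hhA z hz, hgB z hz, logharmonicMap]
  have hbounds : ∀ x ∈ ball (0 : ℂ) 1, α < (1 + eulerDeriv k A x - eulerDeriv k B x).re ∧
      ‖eulerDeriv k B x‖ < ‖1 + eulerDeriv k A x‖ := by
    intro x hx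
    obtain ⟨z, hz, rfl⟩ := exists_pow_eq_mem_ball k hx
    rcases eq_or_ne z 0 with rfl | hz0
    · simpa [NeZero.ne k, eulerDeriv_zero] using hα1
    · exact hS.lt_re_and_norm_lt hα0 hA.differentiableOn hB.differentiableOn hf hz hz0
  exact ⟨A, B, ⟨hA.differentiableOn, hB.differentiableOn, by simpa using hA.apply_zero,
    by simpa using hB.apply_zero, fun x hx => (hbounds x hx).1, fun x hx => (hbounds x hx).2⟩,
    hf, hA, hB⟩

theorem IsStarlikePair.isLogharmonicWith (hP : IsStarlikePair k α A B) :
    IsLogharmonicWith (logharmonicMap k A B)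
      (fun z => eulerDeriv k B (z ^ k) / (1 + eulerDeriv k A (z ^ k))) where
  realDifferentiable z hz := (hasStrictFDerivAt_logharmonicMap hP.differentiableOn_left
    hP.differentiableOn_right hz).hasFDerivAt.differentiableAt
  dilatation_analytic := by
    have hA := differentiableOn_eulerDeriv k hP.differentiableOn_left
    have hB := differentiableOn_eulerDeriv k hP.differentiableOn_right
    exact ((differentiableOn_comp_pow hB).div ((differentiableOn_comp_pow hA).const_add 1)
      fun z hz => hP.one_add_eulerDeriv_ne_zero (pow_mem_ball_zero_one_iff.2 hz)).analyticOnNhd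
        isOpen_ball
  dilatation_lt_one z hz := by
    have hlt := hP.norm_lt (z ^ k) (pow_mem_ball_zero_one_iff.2 hz)
    rwa [norm_div, div_lt_one ((norm_nonneg _).trans_lt hlt)]
  equation z hz := by
    rcases eq_or_ne z 0 with rfl | hz0
    · simp [logharmonicMap_zero]
    · rw [logharmonic_equation_iff hP.differentiableOn_left hP.differentiableOn_right hz hz0,
        div_mul_cancel₀ _ (hP.one_add_eulerDeriv_ne_zero (pow_mem_ball_zero_one_iff.2 hz))]

theorem IsStarlikePair.isSLHkStar (hP : IsStarlikePair k α A B) (hA : HasDiskSeries A a)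
    (hB : HasDiskSeries B b) (hinj : InjOn (logharmonicMap k A B) (ball 0 1)) :
    IsSLHkStar k α (logharmonicMap k A B) (fun z => Complex.exp (A (z ^ k)))
      (fun z => Complex.exp (B (z ^ k)))
      (fun z => eulerDeriv k B (z ^ k) / (1 + eulerDeriv k A (z ^ k)))
      (fun m => a (m / k)) (fun m => b (m / k)) where
  h_analytic := (differentiableOn_comp_pow hA.differentiableOn).cexp.analyticOnNhd isOpen_ball
  g_analytic := (differentiableOn_comp_pow hB.differentiableOn).cexp.analyticOnNhd isOpen_ball
  h_series := hA.isExpSeries hP.left_zero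
  g_series := hB.isExpSeries hP.right_zero
  representation _ _ := rfl
  univalent := hinj
  logharmonic := hP.isLogharmonicWith
  symmetric := isKFoldSymmetric_logharmonicMap
  starlike z hz hz0 := by
    rw [re_starlike_quotient_eq hP.differentiableOn_left hP.differentiableOn_right hz hz0]
    exact hP.lt_re _ (pow_mem_ball_zero_one_iff.2 hz)

end IsStarlikePair

/-! ### The radius equation -/

/-- The distance from the origin to the boundary of the image of the extremal mapping, and a lower
bound of that distance for the whole class. -/
noncomputable def coveringRadius (k : ℕ) (α : ℝ) : ℝ :=
  Real.exp ((-(2 * α * Real.log 2) - 2 * (1 - α)) / k)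

/-- The sharp bound of `log |h g|` in the class, in the variable `x = |z| ^ k`. -/
noncomputable def growthExponent (k : ℕ) (α x : ℝ) : ℝ :=
  (4 * (1 - α) * (x / (1 - x)) - 2 * α * Real.log (1 - x)) / k

/-- The sharp bound of `|z f_z / f|` in the class, in the variable `x = |z| ^ k`. -/
noncomputable def distortionFactor (α x : ℝ) : ℝ :=
  (1 + (1 - 2 * α) * x) / (1 - x) ^ 2

/-- The sharp bound of the Bohr majorant on the circle of radius `r`. -/
noncomputable def sharpMajorant (k : ℕ) (α r : ℝ) : ℝ :=
  r * Real.exp (growthExponent k α (r ^ k)) * (1 + distortionFactor α (r ^ k))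

theorem monotoneOn_of_hasSum_pow {c : ℕ → ℝ} {e : ℕ → ℕ} {F : ℝ → ℝ} {s : Set ℝ}
    (hs : s ⊆ Ici 0) (hc : ∀ n, 0 ≤ c n) (hF : ∀ x ∈ s, HasSum (fun n => c n * x ^ e n) (F x)) :
    MonotoneOn F s := fun x hx y hy hxy =>
  hasSum_le (fun n => mul_le_mul_of_nonneg_left (pow_le_pow_left₀ (hs hx) hxy _) (hc n))
    (hF x hx) (hF y hy)

theorem pow_mem_Ico_zero_one {k : ℕ} [NeZero k] {r : ℝ} (hr : r ∈ Ico (0 : ℝ) 1) :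
    r ^ k ∈ Ico (0 : ℝ) 1 :=
  ⟨pow_nonneg hr.1 k, pow_lt_one₀ hr.1 hr.2 (NeZero.ne k)⟩

theorem hasSum_log_geometric (k : ℕ) (c d : ℝ) {x : ℝ} (hx : x ∈ Ico (0 : ℝ) 1) :
    HasSum (fun n : ℕ => (c + d / (n + 1)) / k * x ^ (n + 1))
      ((c * (x / (1 - x)) - d * Real.log (1 - x)) / k) := by
  have hgeom := (hasSum_geometric_of_lt_one hx.1 hx.2).mul_left (c * x)
  have hlog := (Real.hasSum_pow_div_log_of_abs_lt_one
    (by rw [abs_of_nonneg hx.1]; exact hx.2)).mul_left d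
  convert! (hgeom.add hlog).div_const (k : ℝ) using 1
  · funext n; simp only [pow_succ]; ring
  · rw [div_eq_mul_inv x]; ring

theorem hasSum_distortionFactor (α : ℝ) {x : ℝ} (hx : x ∈ Ico (0 : ℝ) 1) :
    HasSum (fun n : ℕ => (1 + n * (2 * (1 - α))) * x ^ n) (distortionFactor α x) := by
  have hcoe := (hasSum_coe_mul_geometric_of_norm_lt_one (𝕜 := ℝ) (r := x)
    (by rw [Real.norm_of_nonneg hx.1]; exact hx.2)).mul_left (2 * (1 - α))
  have hx1 : 1 - x ≠ 0 := sub_ne_zero.2 hx.2.ne'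
  convert! (hasSum_geometric_of_lt_one hx.1 hx.2).add hcoe using 1
  · funext n; ring
  · rw [distortionFactor]; field_simp; ring

section SharpMajorant

variable {k : ℕ} {α r x : ℝ}

theorem growthExponent_monotoneOn (hα0 : 0 ≤ α) (hα1 : α ≤ 1) :
    MonotoneOn (growthExponent k α) (Ico 0 1) := by
  have : 0 ≤ 1 - α := sub_nonneg.2 hα1
  exact monotoneOn_of_hasSum_pow (fun _ hx => hx.1)
    (c := fun n => (4 * (1 - α) + 2 * α / (n + 1)) / k) (fun n => by positivity)
    fun x hx => hasSum_log_geometric k _ _ hx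

theorem distortionFactor_monotoneOn (hα1 : α ≤ 1) :
    MonotoneOn (distortionFactor α) (Ico 0 1) := by
  have : 0 ≤ 1 - α := sub_nonneg.2 hα1
  exact monotoneOn_of_hasSum_pow (fun _ hx => hx.1)
    (c := fun n => 1 + n * (2 * (1 - α))) (fun n => by positivity)
    fun x hx => hasSum_distortionFactor α hx

theorem growthExponent_nonneg (hα0 : 0 ≤ α) (hα1 : α ≤ 1) (hx : x ∈ Ico (0 : ℝ) 1) :
    0 ≤ growthExponent k α x := by
  simpa [growthExponent] using
    growthExponent_monotoneOn (k := k) hα0 hα1 ⟨le_rfl, zero_lt_one⟩ hx hx.1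

theorem one_le_distortionFactor (hα1 : α ≤ 1) (hx : x ∈ Ico (0 : ℝ) 1) :
    1 ≤ distortionFactor α x := by
  simpa [distortionFactor] using distortionFactor_monotoneOn hα1 ⟨le_rfl, zero_lt_one⟩ hx hx.1

theorem coveringRadius_pos (k : ℕ) (α : ℝ) : 0 < coveringRadius k α :=
  Real.exp_pos _

theorem coveringRadius_le_one (hα0 : 0 ≤ α) (hα1 : α ≤ 1) : coveringRadius k α ≤ 1 := by
  rw [coveringRadius, Real.exp_le_one_iff]
  refine div_nonpos_of_nonpos_of_nonneg ?_ k.cast_nonneg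
  linarith [mul_nonneg hα0 (Real.log_nonneg one_le_two)]

variable [NeZero k]

theorem two_mul_le_sharpMajorant (hα0 : 0 ≤ α) (hα1 : α ≤ 1) (hr : r ∈ Ico (0 : ℝ) 1) :
    2 * r ≤ sharpMajorant k α r := by
  have hx : r ^ k ∈ Ico (0 : ℝ) 1 := pow_mem_Ico_zero_one hr
  have hexp : 1 ≤ Real.exp (growthExponent k α (r ^ k)) :=
    Real.one_le_exp (growthExponent_nonneg hα0 hα1 hx)
  have hfactor : 2 ≤ 1 + distortionFactor α (r ^ k) := by
    linarith [one_le_distortionFactor hα1 hx]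
  rw [mul_comm]
  exact mul_le_mul (le_mul_of_one_le_right hr.1 hexp) hfactor zero_le_two
    (mul_nonneg hr.1 (Real.exp_pos _).le)

theorem sharpMajorant_strictMonoOn (hα0 : 0 ≤ α) (hα1 : α ≤ 1) :
    StrictMonoOn (sharpMajorant k α) (Ico 0 1) := by
  intro r hr s hs hrs
  have hr' : r ^ k ∈ Ico (0 : ℝ) 1 := pow_mem_Ico_zero_one hr
  have hs' : s ^ k ∈ Ico (0 : ℝ) 1 := pow_mem_Ico_zero_one hs
  have hrs' : r ^ k ≤ s ^ k := pow_le_pow_left₀ hr.1 hrs.le k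
  have hgrowth := growthExponent_monotoneOn (k := k) hα0 hα1 hr' hs' hrs'
  have hdist := distortionFactor_monotoneOn hα1 hr' hs' hrs'
  have hdist_pos : 0 < 1 + distortionFactor α (r ^ k) := by
    linarith [one_le_distortionFactor hα1 hr']
  have hs0 : 0 ≤ s := hs.1
  calc sharpMajorant k α r
      < s * Real.exp (growthExponent k α (r ^ k)) * (1 + distortionFactor α (r ^ k)) := by
        rw [sharpMajorant]; gcongr
    _ ≤ sharpMajorant k α s := by rw [sharpMajorant]; gcongr

theorem coveringRadius_mul_radiusFunction (α : ℝ) (hr : r ∈ Ico (0 : ℝ) 1) :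
    coveringRadius k α * radiusFunction k α r = sharpMajorant k α r := by
  have hk0 : (k : ℝ) ≠ 0 := NeZero.ne _
  have hpos : 0 < 1 - r ^ k := sub_pos.2 (pow_mem_Ico_zero_one hr).2
  rw [radiusFunction, sharpMajorant, distortionFactor, growthExponent, coveringRadius,
    mul_comm 2 k, pow_mul]
  generalize r ^ k = x at hpos ⊢
  rw [Real.rpow_def_of_pos two_pos, Real.rpow_def_of_pos hpos]
  have hdenominator : Real.log (1 - x) * (2 * (α + k) / k) =
      Real.log (1 - x) * (2 * α / k) + Real.log (1 - x) + Real.log (1 - x) := by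
    field_simp; ring
  have hgrowth : (4 * (1 - α) * (x / (1 - x)) - 2 * α * Real.log (1 - x)) / k =
      (-(2 * α * Real.log 2) - 2 * (1 - α)) / k + Real.log 2 * (2 * α / k) +
        2 * (1 - α) * (x + 1) / (k * (1 - x)) - Real.log (1 - x) * (2 * α / k) := by
    field_simp; ring
  rw [hdenominator, hgrowth, Real.exp_add _ (Real.log (1 - x)),
    Real.exp_add _ (Real.log (1 - x)), Real.exp_log hpos, Real.exp_sub,
    Real.exp_add _ (2 * (1 - α) * (x + 1) / (k * (1 - x))), Real.exp_add]
  have := Real.exp_pos (Real.log (1 - x) * (2 * α / k))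
  field_simp
  ring

theorem radiusFunction_eq (α : ℝ) (hr : r ∈ Ico (0 : ℝ) 1) :
    radiusFunction k α r = sharpMajorant k α r / coveringRadius k α :=
  eq_div_of_mul_eq (coveringRadius_pos k α).ne'
    ((mul_comm _ _).trans (coveringRadius_mul_radiusFunction α hr))

theorem radiusFunction_strictMonoOn (hα0 : 0 ≤ α) (hα1 : α ≤ 1) :
    StrictMonoOn (radiusFunction k α) (Ico 0 1) := by
  intro r hr s hs hrs
  rw [radiusFunction_eq α hr, radiusFunction_eq α hs]
  exact div_lt_div_of_pos_right (sharpMajorant_strictMonoOn hα0 hα1 hr hs hrs)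
    (coveringRadius_pos k α)

theorem radiusFunction_continuousOn (α : ℝ) :
    ContinuousOn (radiusFunction k α) (Ico 0 1) := by
  have hpos : ∀ r ∈ Ico (0 : ℝ) 1, 0 < 1 - r ^ k := fun r hr =>
    sub_pos.2 (pow_mem_Ico_zero_one hr).2
  unfold radiusFunction
  refine ContinuousOn.mul (ContinuousOn.div (by fun_prop) ?_ ?_)
    (Real.continuous_exp.comp_continuousOn (ContinuousOn.div (by fun_prop) (by fun_prop) ?_))
  · exact ContinuousOn.rpow_const (by fun_prop) fun r hr => Or.inl (hpos r hr).ne'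
  · exact fun r hr => (Real.rpow_pos_of_pos (hpos r hr) _).ne'
  · exact fun r hr => mul_ne_zero (NeZero.ne _) (hpos r hr).ne'

theorem exists_radiusFunction_eq_one (hα0 : 0 ≤ α) (hα1 : α ≤ 1) :
    ∃ r ∈ Ioo (0 : ℝ) 1, radiusFunction k α r = 1 := by
  have hzero : radiusFunction k α 0 = 0 := by simp [radiusFunction]
  have hhalf : (1 / 2 : ℝ) ∈ Ico (0 : ℝ) 1 := by norm_num
  have hone : 1 ≤ radiusFunction k α (1 / 2) := by
    rw [radiusFunction_eq α hhalf, one_le_div (coveringRadius_pos k α)]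
    linarith [two_mul_le_sharpMajorant (k := k) hα0 hα1 hhalf,
      coveringRadius_le_one (k := k) hα0 hα1]
  have hsub : Icc (0 : ℝ) (1 / 2) ⊆ Ico 0 1 := Icc_subset_Ico_right (by norm_num)
  obtain ⟨r, hr, hr1⟩ := intermediate_value_Icc (by norm_num)
    ((radiusFunction_continuousOn α).mono hsub) ⟨hzero.trans_le zero_le_one, hone⟩
  refine ⟨r, ⟨hr.1.lt_of_ne ?_, (hsub hr).2⟩, hr1⟩
  rintro rfl
  exact zero_ne_one (hzero.symm.trans hr1)

end SharpMajorant

/-! ### Sharp bounds in the class -/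

theorem HasDiskSeries.hasSum_succ {F : ℂ → ℂ} {c : ℕ → ℂ} (hF : HasDiskSeries F c) (h0 : F 0 = 0)
    {x : ℂ} (hx : x ∈ ball (0 : ℂ) 1) : HasSum (fun n => c (n + 1) * x ^ (n + 1)) (F x) := by
  simpa [← hF.apply_zero, h0] using (hasSum_nat_add_iff' 1).2 (hF x hx)

theorem HasDiskSeries.norm_le_of_coeff_le {k : ℕ} {c d : ℝ} {A : ℂ → ℂ} {a : ℕ → ℂ}
    (hA : HasDiskSeries A a) (hA0 : A 0 = 0)
    (ha : ∀ n : ℕ, ‖a (n + 1)‖ ≤ (c + d / (n + 1)) / k) {x : ℂ} (hx : x ∈ ball (0 : ℂ) 1) :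
    ‖A x‖ ≤ (c * (‖x‖ / (1 - ‖x‖)) - d * Real.log (1 - ‖x‖)) / k := by
  refine (hA.hasSum_succ hA0 hx).norm_le_of_bounded
    (hasSum_log_geometric k c d ⟨norm_nonneg x, mem_ball_zero_iff.1 hx⟩) fun n => ?_
  rw [norm_mul, norm_pow]
  exact mul_le_mul_of_nonneg_right (ha n) (by positivity)

theorem re_div_pos_of_norm_lt {u v : ℂ} (h : ‖v‖ < ‖u‖) : 0 < ((u + v) / (u - v)).re := by
  have hne : u - v ≠ 0 := sub_ne_zero.2 fun huv => h.ne' (congrArg norm huv)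
  have hsq : ‖v‖ ^ 2 < ‖u‖ ^ 2 := pow_lt_pow_left₀ h (norm_nonneg _) two_ne_zero
  rw [← Complex.normSq_eq_norm_sq, ← Complex.normSq_eq_norm_sq, Complex.normSq_apply,
    Complex.normSq_apply] at hsq
  rw [Complex.div_re, ← add_div]
  refine div_pos ?_ (Complex.normSq_pos.2 hne)
  simp only [Complex.add_re, Complex.sub_re, Complex.add_im, Complex.sub_im]
  linarith

namespace IsStarlikePair

variable {k : ℕ} {α : ℝ} {A B : ℂ → ℂ} {a b : ℕ → ℂ} {x : ℂ}

theorem exists_isCaratheodory (hP : IsStarlikePair k α A B) :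
    ∃ p q : ℂ → ℂ, IsCaratheodory α p ∧ IsCaratheodory 0 q ∧
      EqOn (fun x => 1 + eulerDeriv k A x) (fun x => p x * (2⁻¹ * (q x + 1))) (ball 0 1) ∧
      EqOn (eulerDeriv k B) (fun x => p x * (2⁻¹ * (q x + -1))) (ball 0 1) := by
  have hU : DifferentiableOn ℂ (fun x => 1 + eulerDeriv k A x) (ball 0 1) :=
    (differentiableOn_eulerDeriv k hP.differentiableOn_left).const_add 1
  have hV := differentiableOn_eulerDeriv k hP.differentiableOn_right
  have hne : ∀ x ∈ ball (0 : ℂ) 1, 1 + eulerDeriv k A x - eulerDeriv k B x ≠ 0 := fun x hx =>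
    sub_ne_zero.2 fun h => (hP.norm_lt x hx).ne' (congrArg norm h)
  refine ⟨fun x => 1 + eulerDeriv k A x - eulerDeriv k B x,
    fun x => (1 + eulerDeriv k A x + eulerDeriv k B x) / (1 + eulerDeriv k A x - eulerDeriv k B x),
    ⟨hU.sub hV, by simp [eulerDeriv_zero], hP.lt_re⟩,
    ⟨(hU.add hV).div (hU.sub hV) hne, by simp [eulerDeriv_zero],
      fun x hx => re_div_pos_of_norm_lt (hP.norm_lt x hx)⟩, fun x hx => ?_, fun x hx => ?_⟩ <;>
  · have := hne x hx
    dsimp only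
    field_simp
    ring

theorem norm_one_add_eulerDeriv_le (hP : IsStarlikePair k α A B) (hx : x ∈ ball (0 : ℂ) 1) :
    ‖1 + eulerDeriv k A x‖ ≤ distortionFactor α ‖x‖ := by
  obtain ⟨p, q, hp, hq, hU, -⟩ := hP.exists_isCaratheodory
  have hu := (HasDiskSeries.taylor ((differentiableOn_eulerDeriv k
    hP.differentiableOn_left).const_add 1))
  refine (hu x hx).norm_le_of_bounded
    (hasSum_distortionFactor α ⟨norm_nonneg x, mem_ball_zero_iff.1 hx⟩) fun n => ?_
  rw [norm_mul, norm_pow]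
  exact mul_le_mul_of_nonneg_right (hp.norm_coeff_mul_add_one_le hq (hu.congr_ball hU.symm) n)
    (by positivity)

theorem coveringRadius_le [NeZero k] (hα0 : 0 ≤ α) (hP : IsStarlikePair k α A B)
    (hx : x ∈ ball (0 : ℂ) 1) : coveringRadius k α ≤ Real.exp ((A x).re + (B x).re) := by
  obtain ⟨p, q, hp, hq, hU, hV⟩ := hP.exists_isCaratheodory
  have hderiv : ∀ y ∈ ball (0 : ℂ) 1,
      1 + y * deriv (fun x => (k : ℝ) * (A + B) x) y = p y * q y := by
    intro y hy
    have hAy := (hP.differentiableOn_left.differentiableAt (isOpen_ball.mem_nhds hy)).hasDerivAt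
    have hBy := (hP.differentiableOn_right.differentiableAt (isOpen_ball.mem_nhds hy)).hasDerivAt
    have hUy := hU hy
    have hVy := hV hy
    rw [((hAy.add hBy).const_mul ((k : ℝ) : ℂ)).deriv]
    simp only [eulerDeriv] at hUy hVy
    push_cast
    linear_combination hUy + hVy
  have hre := hp.neg_le_re_of_mul_deriv_eq hq hα0
    ((hP.differentiableOn_left.add hP.differentiableOn_right).const_mul ((k : ℝ) : ℂ))
    (by simp [hP.left_zero, hP.right_zero]) hderiv hx
  rw [Complex.re_ofReal_mul, Pi.add_apply, Complex.add_re] at hre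
  rw [coveringRadius, Real.exp_le_exp, div_le_iff₀ (mod_cast NeZero.pos k)]
  linarith

variable [NeZero k]

theorem norm_coeff_left_le (hP : IsStarlikePair k α A B) (hA : HasDiskSeries A a) (n : ℕ) :
    ‖a (n + 1)‖ ≤ (2 * (1 - α) + 1 / (n + 1)) / k := by
  obtain ⟨p, q, hp, hq, hU, -⟩ := hP.exists_isCaratheodory
  have hcoeff := hp.norm_coeff_mul_add_one_le hq
    (((HasDiskSeries.const 1).add (hA.eulerDeriv k)).congr_ball hU.symm) (n + 1)
  simp only [Pi.single_eq_of_ne n.succ_ne_zero, zero_add, norm_mul, Complex.norm_natCast] at hcoeff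
  have hk : (0 : ℝ) < k := mod_cast NeZero.pos k
  rw [le_div_iff₀' hk, ← mul_le_mul_iff_right₀ (n.cast_add_one_pos (α := ℝ)), mul_add,
    mul_one_div_cancel n.cast_add_one_pos.ne']
  push_cast at hcoeff
  linarith

theorem norm_coeff_right_le (hP : IsStarlikePair k α A B) (hB : HasDiskSeries B b) (n : ℕ) :
    ‖b (n + 1)‖ ≤ (2 * (1 - α) + (2 * α - 1) / (n + 1)) / k := by
  obtain ⟨p, q, hp, hq, -, hV⟩ := hP.exists_isCaratheodory
  have hcoeff := hp.norm_coeff_succ_mul_sub_one_le hq ((hB.eulerDeriv k).congr_ball hV.symm) n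
  simp only [norm_mul, Complex.norm_natCast] at hcoeff
  have hk : (0 : ℝ) < k := mod_cast NeZero.pos k
  rw [le_div_iff₀' hk, ← mul_le_mul_iff_right₀ (n.cast_add_one_pos (α := ℝ)), mul_add,
    mul_div_cancel₀ _ n.cast_add_one_pos.ne']
  push_cast at hcoeff
  linarith

theorem re_add_re_le_growthExponent (hP : IsStarlikePair k α A B) (hx : x ∈ ball (0 : ℂ) 1) :
    (A x).re + (B x).re ≤ growthExponent k α ‖x‖ := by
  have hA := (HasDiskSeries.taylor hP.differentiableOn_left).norm_le_of_coeff_le hP.left_zero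
    (hP.norm_coeff_left_le (.taylor hP.differentiableOn_left)) hx
  have hB := (HasDiskSeries.taylor hP.differentiableOn_right).norm_le_of_coeff_le hP.right_zero
    (hP.norm_coeff_right_le (.taylor hP.differentiableOn_right)) hx
  refine (add_le_add ((Complex.re_le_norm _).trans hA)
    ((Complex.re_le_norm _).trans hB)).trans_eq ?_
  rw [growthExponent]
  ring

variable {z : ℂ} (θ : ℝ)

theorem bohrTerm_le (hP : IsStarlikePair k α A B)
    (hA : HasDiskSeries A (Function.update (fun n => a (n * k)) 0 0))
    (hB : HasDiskSeries B (Function.update (fun n => b (n * k)) 0 0)) (n : ℕ) :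
    bohrTerm k a b θ z n ≤ (4 * (1 - α) + 2 * α / (n + 1)) / k * (‖z‖ ^ k) ^ (n + 1) := by
  rw [bohrTerm, ← pow_mul, mul_comm k]
  refine mul_le_mul_of_nonneg_right ((norm_add_le _ _).trans ?_) (by positivity)
  rw [norm_mul, Complex.norm_exp_ofReal_mul_I, one_mul]
  exact (add_le_add (hP.norm_coeff_left_le hA n) (hP.norm_coeff_right_le hB n)).trans_eq (by ring)

theorem summable_bohrTerm (hP : IsStarlikePair k α A B)
    (hA : HasDiskSeries A (Function.update (fun n => a (n * k)) 0 0))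
    (hB : HasDiskSeries B (Function.update (fun n => b (n * k)) 0 0)) (hz : z ∈ ball (0 : ℂ) 1) :
    Summable (bohrTerm k a b θ z) :=
  .of_nonneg_of_le (fun n => by rw [bohrTerm]; positivity) (hP.bohrTerm_le θ hA hB)
    (hasSum_log_geometric k _ _
      (pow_mem_Ico_zero_one ⟨norm_nonneg z, mem_ball_zero_iff.1 hz⟩)).summable

theorem bohrMajorant_le_sharpMajorant (hP : IsStarlikePair k α A B)
    (hA : HasDiskSeries A (Function.update (fun n => a (n * k)) 0 0))
    (hB : HasDiskSeries B (Function.update (fun n => b (n * k)) 0 0)) (hz : z ∈ ball (0 : ℂ) 1) :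
    bohrMajorant k (logharmonicMap k A B) a b θ z ≤ sharpMajorant k α ‖z‖ := by
  have hx : z ^ k ∈ ball (0 : ℂ) 1 := pow_mem_ball_zero_one_iff.2 hz
  have hbohr : ∑' n, bohrTerm k a b θ z n ≤ growthExponent k α (‖z‖ ^ k) :=
    hasSum_le (hP.bohrTerm_le θ hA hB) (hP.summable_bohrTerm θ hA hB hz).hasSum
      (hasSum_log_geometric k _ _ (pow_mem_Ico_zero_one ⟨norm_nonneg z, mem_ball_zero_iff.1 hz⟩))
  have hgrowth := hP.re_add_re_le_growthExponent hx
  have hdist := hP.norm_one_add_eulerDeriv_le hx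
  rw [norm_pow] at hgrowth hdist
  rw [bohrMajorant, mul_wirtingerZ_logharmonicMap hA.differentiableOn hB.differentiableOn hz,
    norm_mul, norm_logharmonicMap, sharpMajorant, mul_add, mul_one, add_comm]
  gcongr

end IsStarlikePair

/-! ### The distance to the boundary -/

section DiskImage

variable {f : ℂ → ℂ}

theorem le_norm_of_mem_frontier_image {R : ℝ} (hf : ContinuousOn f (ball 0 1))
    (hopen : IsOpen (f '' ball 0 1)) (hR : ∀ z ∈ ball (0 : ℂ) 1, ‖z‖ * R ≤ ‖f z‖) (hR0 : 0 < R)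
    {w : ℂ} (hw : w ∈ frontier (f '' ball 0 1)) : R ≤ ‖w‖ := by
  rw [hopen.frontier_eq] at hw
  by_contra! hwR
  obtain ⟨r, hwr, hr1⟩ := exists_between ((div_lt_one hR0).2 hwR)
  have hsub : closedBall (0 : ℂ) r ⊆ ball 0 1 := closedBall_subset_ball hr1
  have hcover : f '' ball 0 1 ⊆ f '' closedBall 0 r ∪ {v | r * R ≤ ‖v‖} := by
    rintro _ ⟨z, hz, rfl⟩
    rcases le_total ‖z‖ r with h | h
    · exact .inl (mem_image_of_mem f (mem_closedBall_zero_iff.2 h))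
    · exact .inr ((mul_le_mul_of_nonneg_right h hR0.le).trans (hR z hz))
  have hclosed : IsClosed (f '' closedBall 0 r ∪ {v | r * R ≤ ‖v‖}) :=
    ((isCompact_closedBall 0 r).image_of_continuousOn (hf.mono hsub)).isClosed.union
      (isClosed_le continuous_const continuous_norm)
  rcases closure_minimal hcover hclosed hw.1 with h | h
  · exact hw.2 (image_mono hsub h)
  · exact ((div_lt_iff₀ hR0).1 hwr).not_ge h

theorem exists_forall_norm_eq_lt_norm (hopen : ∀ U ⊆ ball (0 : ℂ) 1, IsOpen U → IsOpen (f '' U))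
    (hinj : InjOn f (ball 0 1)) (huniv : f '' ball 0 1 = univ) (C : ℝ) :
    ∃ r ∈ Ioo (0 : ℝ) 1, ∀ z : ℂ, ‖z‖ = r → C < ‖f z‖ := by
  have hsub (r : Ioo (0 : ℝ) 1) : ball (0 : ℂ) r ⊆ ball 0 1 := ball_subset_ball r.2.2.le
  have : Nonempty (Ioo (0 : ℝ) 1) := ⟨1 / 2, by norm_num⟩
  have hcover : closedBall (0 : ℂ) C ⊆ ⋃ r : Ioo (0 : ℝ) 1, f '' ball 0 r := by
    intro w _
    obtain ⟨z, hz, rfl⟩ : w ∈ f '' ball 0 1 := huniv ▸ mem_univ w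
    obtain ⟨r, hzr, hr1⟩ := exists_between (mem_ball_zero_iff.1 hz)
    exact mem_iUnion.2 ⟨⟨r, (norm_nonneg z).trans_lt hzr, hr1⟩,
      mem_image_of_mem f (mem_ball_zero_iff.2 hzr)⟩
  obtain ⟨r, hr⟩ := (isCompact_closedBall (0 : ℂ) C).elim_directed_cover _
    (fun r => hopen _ (hsub r) isOpen_ball) hcover
    (Monotone.directed_le fun _ _ hrs => image_mono (ball_subset_ball hrs))
  refine ⟨r, r.2, fun z hz => not_le.1 fun hle => ?_⟩
  obtain ⟨v, hv, hvz⟩ := hr (mem_closedBall_zero_iff.2 hle)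
  rw [hinj (hsub r hv) (mem_ball_zero_iff.2 (hz.trans_lt r.2.2)) hvz, mem_ball_zero_iff, hz] at hv
  exact lt_irrefl _ hv

theorem notMem_image_of_tendsto (hopen : ∀ U ⊆ ball (0 : ℂ) 1, IsOpen U → IsOpen (f '' U))
    (hinj : InjOn f (ball 0 1)) {ι : Type*} {l : Filter ι} [l.NeBot] {u : ι → ℂ}
    (hu : ∀ᶠ i in l, u i ∈ ball (0 : ℂ) 1) {ζ w : ℂ} (hζ : ‖ζ‖ = 1) (huζ : Tendsto u l (𝓝 ζ))
    (hfw : Tendsto (fun i => f (u i)) l (𝓝 w)) : w ∉ f '' ball 0 1 := by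
  rintro ⟨z, hz, rfl⟩
  obtain ⟨r, hzr, hr1⟩ := exists_between (mem_ball_zero_iff.1 hz)
  have hsub : ball (0 : ℂ) r ⊆ ball 0 1 := ball_subset_ball hr1.le
  have hnhds : f '' ball 0 r ∈ 𝓝 (f z) := (hopen _ hsub isOpen_ball).mem_nhds
    (mem_image_of_mem f (mem_ball_zero_iff.2 hzr))
  have hle : ‖ζ‖ ≤ r := by
    refine le_of_tendsto huζ.norm ?_
    filter_upwards [hu, hfw hnhds] with i hi hfi
    obtain ⟨v, hv, hvi⟩ := hfi
    rw [← hinj (hsub hv) hi hvi]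
    exact (mem_ball_zero_iff.1 hv).le
  exact (hr1.trans_le hζ.ge).not_ge hle

end DiskImage

namespace IsStarlikePair

variable {k : ℕ} [NeZero k] {α : ℝ} {A B : ℂ → ℂ}

theorem norm_wirtingerZbar_lt (hP : IsStarlikePair k α A B) {z : ℂ} (hz : z ∈ ball (0 : ℂ) 1) :
    ‖z * Complex.exp (A (z ^ k)) * conj (Complex.exp (B (z ^ k)) *
        (deriv B (z ^ k) * (k * z ^ (k - 1))))‖ <
      ‖Complex.exp (A (z ^ k)) * conj (Complex.exp (B (z ^ k))) *
        (1 + eulerDeriv k A (z ^ k))‖ := by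
  have hx := hP.norm_lt (z ^ k) (pow_mem_ball_zero_one_iff.2 hz)
  have hexp : 0 < ‖Complex.exp (A (z ^ k))‖ * ‖Complex.exp (B (z ^ k))‖ :=
    mul_pos (norm_pos_iff.2 (Complex.exp_ne_zero _)) (norm_pos_iff.2 (Complex.exp_ne_zero _))
  calc _ = ‖Complex.exp (A (z ^ k))‖ * ‖Complex.exp (B (z ^ k))‖ * ‖eulerDeriv k B (z ^ k)‖ := by
        rw [eulerDeriv, ← mul_pow_sub_one (NeZero.ne k) z]
        simp only [norm_mul, RCLike.norm_conj]
        ring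
    _ < ‖Complex.exp (A (z ^ k))‖ * ‖Complex.exp (B (z ^ k))‖ * ‖1 + eulerDeriv k A (z ^ k)‖ := by
        gcongr
    _ = _ := by simp only [norm_mul, RCLike.norm_conj]

theorem isOpen_image (hP : IsStarlikePair k α A B) (U : Set ℂ) (hU : U ⊆ ball 0 1)
    (hUo : IsOpen U) : IsOpen (logharmonicMap k A B '' U) := by
  rw [isOpen_iff_mem_nhds]
  rintro _ ⟨z, hz, rfl⟩
  rw [← (hasStrictFDerivAt_logharmonicMap hP.differentiableOn_left hP.differentiableOn_right
    (hU hz)).map_nhds_eq_of_surj (range_wirtingerMap_eq_top (hP.norm_wirtingerZbar_lt (hU hz)))]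
  exact image_mem_map (hUo.mem_nhds hz)

theorem continuousOn_logharmonicMap (hP : IsStarlikePair k α A B) :
    ContinuousOn (logharmonicMap k A B) (ball 0 1) := fun _ hz =>
  (hasStrictFDerivAt_logharmonicMap hP.differentiableOn_left
    hP.differentiableOn_right hz).continuousAt.continuousWithinAt

/-- If the image were the whole plane, `|f|` would exceed `2` on a circle `|z| = r`, hence
`exp (-(A (z ^ k) + B (z ^ k)))` would be at most `1 / 2` there but `1` at the center. -/
theorem image_ne_univ (hP : IsStarlikePair k α A B)
    (hinj : InjOn (logharmonicMap k A B) (ball 0 1)) :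
    logharmonicMap k A B '' ball 0 1 ≠ univ := by
  intro huniv
  obtain ⟨r, hr, hlarge⟩ := exists_forall_norm_eq_lt_norm hP.isOpen_image hinj huniv 2
  have hdiff : DiffContOnCl ℂ (fun z => Complex.exp (-(A (z ^ k) + B (z ^ k)))) (ball 0 r) :=
    DifferentiableOn.diffContOnCl_ball (U := ball 0 1)
      ((differentiableOn_comp_pow hP.differentiableOn_left).add
        (differentiableOn_comp_pow hP.differentiableOn_right)).neg.cexp
      (closedBall_subset_ball hr.2)
  have hbound : ∀ z ∈ frontier (ball (0 : ℂ) r),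
      ‖Complex.exp (-(A (z ^ k) + B (z ^ k)))‖ ≤ 2⁻¹ := by
    intro z hz
    have hzr : ‖z‖ = r := by simpa [frontier_ball _ hr.1.ne'] using hz
    have hnorm := hlarge z hzr
    rw [norm_logharmonicMap, hzr] at hnorm
    rw [Complex.norm_exp, Complex.neg_re, Complex.add_re, Real.exp_neg]
    exact inv_anti₀ two_pos
      (hnorm.le.trans (mul_le_of_le_one_left (Real.exp_pos _).le hr.2.le))
  have hcenter := Complex.norm_le_of_forall_mem_frontier_norm_le isBounded_ball hdiff hbound
    (subset_closure (mem_ball_self hr.1))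
  rw [zero_pow (NeZero.ne k), hP.left_zero, hP.right_zero] at hcenter
  norm_num at hcenter

theorem coveringRadius_le_boundaryDist (hα0 : 0 ≤ α) (hP : IsStarlikePair k α A B)
    (hinj : InjOn (logharmonicMap k A B) (ball 0 1)) :
    coveringRadius k α ≤ boundaryDist (logharmonicMap k A B) := by
  rw [boundaryDist, unitDisk, logharmonicMap_zero]
  refine (le_infDist (nonempty_frontier_iff.2
    ⟨(nonempty_ball.2 one_pos).image _, hP.image_ne_univ hinj⟩)).2 fun w hw => ?_
  rw [dist_zero_left]
  refine le_norm_of_mem_frontier_image hP.continuousOn_logharmonicMap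
    (hP.isOpen_image _ subset_rfl isOpen_ball) (fun z hz => ?_) (coveringRadius_pos k α) hw
  rw [norm_logharmonicMap]
  exact mul_le_mul_of_nonneg_left
    (hP.coveringRadius_le hα0 (pow_mem_ball_zero_one_iff.2 hz)) (norm_nonneg z)

theorem boundaryDist_le_norm_of_tendsto (hP : IsStarlikePair k α A B)
    (hinj : InjOn (logharmonicMap k A B) (ball 0 1)) {ι : Type*} {l : Filter ι} [l.NeBot]
    {u : ι → ℂ} (hu : ∀ᶠ i in l, u i ∈ ball (0 : ℂ) 1) {ζ w : ℂ} (hζ : ‖ζ‖ = 1)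
    (huζ : Tendsto u l (𝓝 ζ)) (hfw : Tendsto (fun i => logharmonicMap k A B (u i)) l (𝓝 w)) :
    boundaryDist (logharmonicMap k A B) ≤ ‖w‖ := by
  rw [boundaryDist, unitDisk, logharmonicMap_zero, ← dist_zero_left]
  refine infDist_le_dist_of_mem ?_
  rw [(hP.isOpen_image _ subset_rfl isOpen_ball).frontier_eq]
  exact ⟨mem_closure_of_tendsto hfw (hu.mono fun i hi => mem_image_of_mem _ hi),
    notMem_image_of_tendsto hP.isOpen_image hinj hu hζ huζ hfw⟩

end IsStarlikePair

/-! ### An injective function on a half-plane -/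

section HalfPlane

variable {β c χ : ℝ} {y w : ℂ}

theorem arg_mem_Ioo_of_im_pos (hy : 0 < y.im) : y.arg ∈ Ioo 0 Real.pi := by
  refine ⟨(Complex.arg_nonneg_iff.2 hy.le).lt_of_ne fun h => ?_,
    Complex.arg_lt_pi_iff.2 (.inr hy.ne')⟩
  exact hy.ne' (Complex.arg_eq_zero_iff.1 h.symm).2

theorem norm_mul_sin_arg_sub_one_sub_arg (hy : 0 < y.im) :
    ‖y‖ * Real.sin ((y - 1).arg - y.arg) = Real.sin (y - 1).arg := by
  have hne : ‖y - 1‖ ≠ 0 :=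
    norm_ne_zero_iff.2 fun h => by simpa [hy.ne'] using congrArg Complex.im h
  have h1 := Complex.norm_mul_sin_arg (y - 1)
  have h2 := Complex.norm_mul_cos_arg (y - 1)
  simp only [Complex.sub_re, Complex.sub_im, Complex.one_re, Complex.one_im, sub_zero] at h1 h2
  apply mul_left_cancel₀ hne
  rw [Real.sin_sub]
  grind [Complex.norm_mul_sin_arg y, Complex.norm_mul_cos_arg y]

theorem norm_sub_one_mul_sin_arg_sub_one_sub_arg (hy : 0 < y.im) :
    ‖y - 1‖ * Real.sin ((y - 1).arg - y.arg) = Real.sin y.arg := by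
  have hne : ‖y‖ ≠ 0 := norm_ne_zero_iff.2 fun h => hy.ne' (by simp [h])
  have h1 := Complex.norm_mul_sin_arg (y - 1)
  have h2 := Complex.norm_mul_cos_arg (y - 1)
  simp only [Complex.sub_re, Complex.sub_im, Complex.one_re, Complex.one_im, sub_zero] at h1 h2
  apply mul_left_cancel₀ hne
  rw [Real.sin_sub]
  grind [Complex.norm_mul_sin_arg y, Complex.norm_mul_cos_arg y]

theorem arg_lt_arg_sub_one (hy : 0 < y.im) : y.arg < (y - 1).arg := by
  have hχ := arg_mem_Ioo_of_im_pos hy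
  have hψ := arg_mem_Ioo_of_im_pos (y := y - 1) (by simpa using hy)
  have hsin : 0 < ‖y‖ * Real.sin ((y - 1).arg - y.arg) := by
    rw [norm_mul_sin_arg_sub_one_sub_arg hy]
    exact Real.sin_pos_of_mem_Ioo hψ
  by_contra! hle
  refine (pos_of_mul_pos_right hsin (norm_nonneg y)).not_ge
    (Real.sin_nonpos_of_nonpos_of_neg_pi_le ?_ ?_) <;> linarith [hχ.1, hχ.2, hψ.1, hψ.2]

theorem arg_add_arg_sub_one_lt_pi (hre : 1 / 2 < y.re) (hy : 0 < y.im) :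
    y.arg + (y - 1).arg < Real.pi := by
  have hχ := arg_mem_Ioo_of_im_pos hy
  have hψ := arg_mem_Ioo_of_im_pos (y := y - 1) (by simpa using hy)
  have hsin : ‖y‖ * ‖y - 1‖ * Real.sin (y.arg + (y - 1).arg) = y.im * (2 * y.re - 1) := by
    have h1 := Complex.norm_mul_sin_arg (y - 1)
    have h2 := Complex.norm_mul_cos_arg (y - 1)
    simp only [Complex.sub_re, Complex.sub_im, Complex.one_re, Complex.one_im, sub_zero] at h1 h2
    rw [Real.sin_add]
    grind [Complex.norm_mul_sin_arg y, Complex.norm_mul_cos_arg y]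
  by_contra! hle
  have hnonpos : Real.sin (y.arg + (y - 1).arg) ≤ 0 := by
    rw [← Real.sin_sub_two_pi]
    refine Real.sin_nonpos_of_nonpos_of_neg_pi_le ?_ ?_ <;> linarith [hχ.2, hψ.2]
  have hpos : 0 < y.im * (2 * y.re - 1) := mul_pos hy (by linarith)
  exact hpos.not_ge (hsin ▸ mul_nonpos_of_nonneg_of_nonpos (by positivity) hnonpos)

/-- The extremal mapping in the half-plane `Re y > 1 / 2`: for `β = 1 - 2 * α`, its `k`-th power
is `halfPlaneMap β` at `y = 1 / (1 - z ^ k)`. -/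
noncomputable def halfPlaneMap (β : ℝ) (y : ℂ) : ℂ :=
  (y - 1) * Complex.exp (-β * conj (Complex.log y) + 2 * (1 + β) * (y.re - 1))

/-- The logarithm of the modulus of `halfPlaneMap β y`, up to the constant `2 * (1 + β)`, as a
function of the angles `χ = arg y` and `ψ = arg (y - 1)` of the triangle with vertices `0, 1, y`,
whose angle at `y` is `ψ - χ`. -/
noncomputable def triangleModulus (β χ ψ : ℝ) : ℝ :=
  Real.log (Real.sin χ) - Real.log (Real.sin (ψ - χ))
    - β * (Real.log (Real.sin ψ) - Real.log (Real.sin (ψ - χ)))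
    + 2 * (1 + β) * (Real.sin ψ * Real.cos χ / Real.sin (ψ - χ))

/-- The angles `χ = arg y` at which the curve `arg (halfPlaneMap β y) = c` meets the quadrant
`Re y > 1 / 2`, `Im y > 0`. On this curve `arg (y - 1) = c - β * χ`. -/
def levelAngles (β c : ℝ) : Set ℝ :=
  {χ | 0 < χ ∧ χ < c - β * χ ∧ χ + (c - β * χ) < Real.pi}

theorem convex_levelAngles (β c : ℝ) : Convex ℝ (levelAngles β c) := by
  refine convex_iff_forall_pos.2 ?_
  rintro χ₁ ⟨h1, h2, h3⟩ χ₂ ⟨h1', h2', h3'⟩ s t hs ht hst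
  obtain rfl : t = 1 - s := by linarith
  refine ⟨?_, ?_, ?_⟩ <;> simp only [smul_eq_mul] <;> nlinarith

theorem triangleModulus_deriv_identity {a b s t p q : ℝ} (ha : a ≠ 0) (hs : s ≠ 0) (hp : p ≠ 0)
    (hab : a ^ 2 + b ^ 2 = 1) (hst : s ^ 2 + t ^ 2 = 1) (hpe : p = a * t + b * s)
    (hqe : q = b * t - a * s) :
    b / a - -(1 + β) * t / s - β * (-β * q / p - -(1 + β) * t / s)
      + 2 * (1 + β) * (((-β * q * b + p * -a) * s - p * b * (-(1 + β) * t)) / s ^ 2)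
      = (p * b + q * a) * ((β * a + t * p) ^ 2 + p ^ 2 * s ^ 2) / (a * s ^ 2 * p) := by
  field_simp
  grind

theorem hasDerivAt_triangleModulus (hχ : χ ∈ levelAngles β c) :
    HasDerivAt (fun χ => triangleModulus β χ (c - β * χ))
      (Real.sin (c - β * χ + χ) * ((β * Real.sin χ +
        Real.cos (c - β * χ - χ) * Real.sin (c - β * χ)) ^ 2 +
        Real.sin (c - β * χ) ^ 2 * Real.sin (c - β * χ - χ) ^ 2) /
        (Real.sin χ * Real.sin (c - β * χ - χ) ^ 2 * Real.sin (c - β * χ))) χ := by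
  obtain ⟨hχ0, hδ, hπ⟩ := hχ
  have ha := (Real.sin_pos_of_mem_Ioo (x := χ) ⟨by linarith, by linarith⟩).ne'
  have hs := (Real.sin_pos_of_mem_Ioo (x := c - β * χ - χ) ⟨by linarith, by linarith⟩).ne'
  have hp := (Real.sin_pos_of_mem_Ioo (x := c - β * χ) ⟨by linarith, by linarith⟩).ne'
  have dψ : HasDerivAt (fun χ => c - β * χ) (-β) χ := (hasDerivAt_const_mul β).const_sub c
  have dδ : HasDerivAt (fun χ => c - β * χ - χ) (-(1 + β)) χ :=
    (dψ.sub (hasDerivAt_id χ)).congr_deriv (by ring)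
  have dlogχ := (Real.hasDerivAt_sin χ).log ha
  have dlogδ := dδ.sin.log hs
  have dlogψ := dψ.sin.log hp
  have dquot := (dψ.sin.mul (Real.hasDerivAt_cos χ)).div dδ.sin hs
  have hψ : c - β * χ = χ + (c - β * χ - χ) := by ring
  rw [Real.sin_add, ← triangleModulus_deriv_identity ha hs hp (Real.sin_sq_add_cos_sq χ)
    (Real.sin_sq_add_cos_sq _) ((congrArg Real.sin hψ).trans (Real.sin_add _ _))
    ((congrArg Real.cos hψ).trans (Real.cos_add _ _))]
  refine (((dlogχ.sub dlogδ).sub ((dlogψ.sub dlogδ).const_mul β)).add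
    (dquot.const_mul (2 * (1 + β)))).congr_deriv ?_
  simp only [Pi.mul_apply]
  ring

theorem triangleModulus_strictMonoOn (β c : ℝ) :
    StrictMonoOn (fun χ => triangleModulus β χ (c - β * χ)) (levelAngles β c) := by
  refine strictMonoOn_of_deriv_pos (convex_levelAngles β c)
    (fun χ hχ => (hasDerivAt_triangleModulus hχ).continuousAt.continuousWithinAt) fun χ hχ => ?_
  have hmem := interior_subset hχ
  obtain ⟨hχ0, hδ, hπ⟩ := hmem
  have hsinχ := Real.sin_pos_of_mem_Ioo (x := χ) ⟨by linarith, by linarith⟩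
  have hsinδ := Real.sin_pos_of_mem_Ioo (x := c - β * χ - χ) ⟨by linarith, by linarith⟩
  have hsinψ := Real.sin_pos_of_mem_Ioo (x := c - β * χ) ⟨by linarith, by linarith⟩
  have hsin := Real.sin_pos_of_mem_Ioo (x := c - β * χ + χ) ⟨by linarith, by linarith⟩
  rw [(hasDerivAt_triangleModulus ⟨hχ0, hδ, hπ⟩).deriv]
  positivity

theorem halfPlaneMap_eq_exp (β : ℝ) (hy : 0 < y.im) :
    halfPlaneMap β y = Complex.exp ((triangleModulus β y.arg (y - 1).arg - 2 * (1 + β) : ℝ)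
      + ((y - 1).arg + β * y.arg : ℝ) * Complex.I) := by
  have hχ := Real.sin_pos_of_mem_Ioo (arg_mem_Ioo_of_im_pos hy)
  have hψ := Real.sin_pos_of_mem_Ioo (arg_mem_Ioo_of_im_pos (y := y - 1) (by simpa using hy))
  have hδ : 0 < Real.sin ((y - 1).arg - y.arg) :=
    pos_of_mul_pos_right (norm_mul_sin_arg_sub_one_sub_arg hy ▸ hψ) (norm_nonneg y)
  have hne : y - 1 ≠ 0 := fun h => by simpa [hy.ne'] using congrArg Complex.im h
  have hnorm := eq_div_of_mul_eq hδ.ne' (norm_mul_sin_arg_sub_one_sub_arg hy)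
  have hnorm_sub_one := eq_div_of_mul_eq hδ.ne' (norm_sub_one_mul_sin_arg_sub_one_sub_arg hy)
  have hre : y.re = Real.sin (y - 1).arg * Real.cos y.arg / Real.sin ((y - 1).arg - y.arg) := by
    rw [← Complex.norm_mul_cos_arg y, hnorm]
    ring
  rw [halfPlaneMap, ← Complex.exp_log hne, ← Complex.exp_add, Complex.exp_log hne, Complex.log,
    Complex.log, hnorm, hnorm_sub_one, hre, Real.log_div hψ.ne' hδ.ne', Real.log_div hχ.ne' hδ.ne',
    triangleModulus]
  congr 1
  simp only [map_add, map_mul, Complex.conj_ofReal, Complex.conj_I]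
  push_cast
  ring

theorem arg_sub_one_add_mul_arg_mem_Ioo (hβ : -1 < β) (hβ1 : β ≤ 1) (hre : 1 / 2 < y.re)
    (hy : 0 < y.im) : (y - 1).arg + β * y.arg ∈ Ioo 0 Real.pi := by
  have hχ := (arg_mem_Ioo_of_im_pos hy).1
  constructor <;> nlinarith [arg_lt_arg_sub_one hy, arg_add_arg_sub_one_lt_pi hre hy]

theorem halfPlaneMap_im_pos (hβ : -1 < β) (hβ1 : β ≤ 1) (hre : 1 / 2 < y.re) (hy : 0 < y.im) :
    0 < (halfPlaneMap β y).im := by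
  rw [halfPlaneMap_eq_exp β hy, Complex.exp_add, ← Complex.ofReal_exp, Complex.im_ofReal_mul,
    Complex.exp_ofReal_mul_I_im]
  exact mul_pos (Real.exp_pos _)
    (Real.sin_pos_of_mem_Ioo (arg_sub_one_add_mul_arg_mem_Ioo hβ hβ1 hre hy))

theorem eq_of_arg_eq_of_arg_sub_one_eq (hy : 0 < y.im) (hw : 0 < w.im) (harg : y.arg = w.arg)
    (harg_sub_one : (y - 1).arg = (w - 1).arg) : y = w := by
  refine Complex.ext_norm_arg (mul_right_cancel₀
    (Real.sin_pos_of_mem_Ioo (x := (y - 1).arg - y.arg) ⟨?_, ?_⟩).ne' ?_) harg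
  · exact sub_pos.2 (arg_lt_arg_sub_one hy)
  · linarith [(arg_mem_Ioo_of_im_pos hy).1, Complex.arg_le_pi (y - 1)]
  · rw [norm_mul_sin_arg_sub_one_sub_arg hy, harg, harg_sub_one,
      norm_mul_sin_arg_sub_one_sub_arg hw]

theorem halfPlaneMap_injOn_im_pos (hβ : -1 < β) (hβ1 : β ≤ 1) :
    InjOn (halfPlaneMap β) {y | 1 / 2 < y.re ∧ 0 < y.im} := by
  rintro y ⟨hyre, hyim⟩ w ⟨hwre, hwim⟩ h
  have hy := arg_sub_one_add_mul_arg_mem_Ioo hβ hβ1 hyre hyim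
  have hw := arg_sub_one_add_mul_arg_mem_Ioo hβ hβ1 hwre hwim
  rw [halfPlaneMap_eq_exp β hyim, halfPlaneMap_eq_exp β hwim] at h
  have hexp := Complex.exp_inj_of_neg_pi_lt_of_le_pi (by simp; linarith [hy.1, Real.pi_pos])
    (by simpa using hy.2.le) (by simp; linarith [hw.1, Real.pi_pos]) (by simpa using hw.2.le) h
  have hmod : triangleModulus β y.arg (y - 1).arg = triangleModulus β w.arg (w - 1).arg := by
    simpa using congrArg Complex.re hexp
  have hlevel : (y - 1).arg + β * y.arg = (w - 1).arg + β * w.arg := by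
    simpa using congrArg Complex.im hexp
  set c := (y - 1).arg + β * y.arg with hc
  have hψy : (y - 1).arg = c - β * y.arg := by linarith
  have hψw : (w - 1).arg = c - β * w.arg := by linarith
  have hχ : y.arg = w.arg := by
    refine (triangleModulus_strictMonoOn β c).injOn
      ⟨(arg_mem_Ioo_of_im_pos hyim).1, hψy ▸ arg_lt_arg_sub_one hyim, ?_⟩
      ⟨(arg_mem_Ioo_of_im_pos hwim).1, hψw ▸ arg_lt_arg_sub_one hwim, ?_⟩
      (by rwa [hψy, hψw] at hmod)
    · exact hψy ▸ arg_add_arg_sub_one_lt_pi hyre hyim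
    · exact hψw ▸ arg_add_arg_sub_one_lt_pi hwre hwim
  exact eq_of_arg_eq_of_arg_sub_one_eq hyim hwim hχ (by rw [hψy, hψw, hχ])

theorem halfPlaneMap_conj (β : ℝ) (hy : y ∈ Complex.slitPlane) :
    halfPlaneMap β (conj y) = conj (halfPlaneMap β y) := by
  simp only [halfPlaneMap, Complex.log_conj y (Complex.slitPlane_arg_ne_pi hy), map_mul,
    ← Complex.exp_conj, map_sub, map_one, map_add, map_neg, Complex.conj_ofReal, Complex.conj_conj,
    Complex.conj_re, map_ofNat]

theorem halfPlaneMap_ofReal (β : ℝ) {t : ℝ} (ht : 0 ≤ t) :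
    halfPlaneMap β t =
      ((t - 1) * Real.exp (-β * Real.log t + 2 * (1 + β) * (t - 1)) : ℝ) := by
  rw [halfPlaneMap, ← Complex.ofReal_log ht, Complex.conj_ofReal, Complex.ofReal_re]
  push_cast
  rfl

theorem strictMonoOn_halfPlaneMap_ofReal (hβ : -1 < β) (hβ1 : β ≤ 1) :
    StrictMonoOn (fun t => (t - 1) * Real.exp (-β * Real.log t + 2 * (1 + β) * (t - 1)))
      (Ioi (1 / 2)) := by
  have hderiv (t : ℝ) (ht : t ∈ Ioi (1 / 2 : ℝ)) : HasDerivAt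
      (fun t => (t - 1) * Real.exp (-β * Real.log t + 2 * (1 + β) * (t - 1)))
      (Real.exp (-β * Real.log t + 2 * (1 + β) * (t - 1)) *
        ((2 * t - 1) * ((1 + β) * t - β) / t)) t := by
    have ht0 : t ≠ 0 := (one_half_pos.trans ht).ne'
    have dsub : HasDerivAt (fun t : ℝ => t - 1) 1 t := (hasDerivAt_id t).sub_const 1
    have dexp := (((Real.hasDerivAt_log ht0).const_mul (-β)).add
      (dsub.const_mul (2 * (1 + β)))).exp
    refine (dsub.mul dexp).congr_deriv ?_
    simp only [Pi.add_apply]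
    field_simp
    ring
  refine strictMonoOn_of_deriv_pos (convex_Ioi _)
    (fun t ht => (hderiv t ht).continuousAt.continuousWithinAt) fun t ht => ?_
  rw [interior_Ioi] at ht
  rw [(hderiv t ht).deriv]
  rw [mem_Ioi] at ht
  exact mul_pos (Real.exp_pos _) (div_pos (mul_pos (by linarith) (by nlinarith)) (by linarith))

theorem halfPlaneMap_injOn_im_eq_zero (hβ : -1 < β) (hβ1 : β ≤ 1) :
    InjOn (halfPlaneMap β) {y | 1 / 2 < y.re ∧ y.im = 0} := by
  rintro y ⟨hyre, hyim⟩ w ⟨hwre, hwim⟩ h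
  lift y to ℝ using hyim
  lift w to ℝ using hwim
  rw [Complex.ofReal_re] at hyre hwre
  rw [halfPlaneMap_ofReal β (by linarith), halfPlaneMap_ofReal β (by linarith),
    Complex.ofReal_inj] at h
  rw [(strictMonoOn_halfPlaneMap_ofReal hβ hβ1).injOn hyre hwre h]

theorem sign_halfPlaneMap_im (hβ : -1 < β) (hβ1 : β ≤ 1) (hre : 1 / 2 < y.re) :
    SignType.sign (halfPlaneMap β y).im = SignType.sign y.im := by
  rcases lt_trichotomy y.im 0 with hy | hy | hy
  · have := halfPlaneMap_im_pos hβ hβ1 (y := conj y) (by simpa using hre) (by simpa using hy)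
    rw [halfPlaneMap_conj β (.inl (by linarith)), Complex.conj_im, neg_pos] at this
    rw [sign_neg this, sign_neg hy]
  · lift y to ℝ using hy
    rw [Complex.ofReal_re] at hre
    rw [halfPlaneMap_ofReal β (by linarith), Complex.ofReal_im, Complex.ofReal_im]
  · rw [sign_pos (halfPlaneMap_im_pos hβ hβ1 hre hy), sign_pos hy]

theorem halfPlaneMap_injOn (hβ : -1 < β) (hβ1 : β ≤ 1) :
    InjOn (halfPlaneMap β) {y | 1 / 2 < y.re} := by
  intro y (hy : 1 / 2 < y.re) w (hw : 1 / 2 < w.re) h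
  have hsign : SignType.sign y.im = SignType.sign w.im := by
    rw [← sign_halfPlaneMap_im hβ hβ1 hy, h, sign_halfPlaneMap_im hβ hβ1 hw]
  rcases lt_trichotomy y.im 0 with hyim | hyim | hyim
  · have hwim : w.im < 0 := sign_eq_neg_one_iff.1 (hsign ▸ sign_neg hyim)
    refine (starRingEnd ℂ).injective (halfPlaneMap_injOn_im_pos hβ hβ1 (x₁ := conj y)
      (x₂ := conj w) ⟨by simpa using hy, by simpa using hyim⟩
      ⟨by simpa using hw, by simpa using hwim⟩ ?_)
    rw [halfPlaneMap_conj β (.inl (by linarith)), halfPlaneMap_conj β (.inl (by linarith)), h]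
  · have hwim : w.im = 0 := sign_eq_zero_iff.1 (hsign ▸ sign_eq_zero_iff.2 hyim)
    exact halfPlaneMap_injOn_im_eq_zero hβ hβ1 ⟨hy, hyim⟩ ⟨hw, hwim⟩ h
  · have hwim : 0 < w.im := sign_eq_one_iff.1 (hsign ▸ sign_pos hyim)
    exact halfPlaneMap_injOn_im_pos hβ hβ1 ⟨hy, hyim⟩ ⟨hw, hwim⟩ h

end HalfPlane

/-! ### The extremal mapping -/

/-- The exponents `log h` and `log g` of the extremal mapping, in the variable `z ^ k`, are of this
form, with `c / (1 - x) ^ 2` the leading term of the derivative at the singular point `x = 1`. -/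
noncomputable def logGeometric (k : ℕ) (c d : ℝ) (x : ℂ) : ℂ :=
  (c * (x / (1 - x)) - d * Complex.log (1 - x)) / k

/-- The Taylor coefficients of `logGeometric k c d`; the constant term is separated because
`c + d / 0 = c`. -/
noncomputable def logGeometricCoeff (k : ℕ) (c d : ℝ) (n : ℕ) : ℂ :=
  if n = 0 then 0 else ((c + d / n) / k : ℝ)

section LogGeometric

variable {k : ℕ} {c d : ℝ} {x : ℂ}

theorem one_half_lt_re_inv_one_sub (hx : x ∈ ball (0 : ℂ) 1) : 1 / 2 < ((1 - x)⁻¹).re := by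
  have hx1 : ‖x‖ < 1 := mem_ball_zero_iff.1 hx
  have hne : 1 - x ≠ 0 := sub_ne_zero.2 fun h => by simp [← h] at hx1
  have hsq : Complex.normSq x < 1 := by
    rw [Complex.normSq_eq_norm_sq]
    exact pow_lt_one₀ (norm_nonneg x) hx1 two_ne_zero
  rw [Complex.inv_re, lt_div_iff₀ (Complex.normSq_pos.2 hne)]
  rw [Complex.normSq_apply] at hsq ⊢
  simp only [Complex.sub_re, Complex.one_re, Complex.sub_im, Complex.one_im]
  linarith

theorem one_sub_mem_slitPlane (hx : x ∈ ball (0 : ℂ) 1) : 1 - x ∈ Complex.slitPlane :=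
  .inl (by simpa using (Complex.re_le_norm x).trans_lt (mem_ball_zero_iff.1 hx))

theorem hasDerivAt_logGeometric (hx : 1 - x ∈ Complex.slitPlane) :
    HasDerivAt (logGeometric k c d) ((c / (1 - x) ^ 2 + d / (1 - x)) / k) x := by
  have hne : 1 - x ≠ 0 := Complex.slitPlane_ne_zero hx
  have hsub : HasDerivAt (fun x : ℂ => 1 - x) (-1) x := (hasDerivAt_id x).const_sub 1
  refine ((((hasDerivAt_id x).div hsub hne).const_mul (c : ℂ)).sub
    ((hsub.clog hx).const_mul (d : ℂ))).div_const (k : ℂ) |>.congr_deriv ?_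
  simp only [id]
  field_simp
  ring

theorem hasDiskSeries_logGeometric :
    HasDiskSeries (logGeometric k c d) (logGeometricCoeff k c d) := by
  intro x hx
  have hx1 : ‖x‖ < 1 := mem_ball_zero_iff.1 hx
  have hgeom := (hasSum_geometric_of_norm_lt_one hx1).mul_left ((c : ℂ) * x)
  have hlog := Complex.hasSum_taylorSeries_neg_log hx1
  rw [← hasSum_nat_add_iff' 1] at hlog ⊢
  convert! (hgeom.add (hlog.mul_left (d : ℂ))).div_const (k : ℂ) using 1
  · funext n
    simp only [logGeometricCoeff, Nat.succ_ne_zero, if_false, pow_succ]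
    push_cast
    ring
  · simp only [logGeometric, logGeometricCoeff, Finset.sum_range_one, if_true, zero_mul,
      CharP.cast_eq_zero, div_zero, sub_zero]
    ring

theorem logGeometric_zero : logGeometric k c d 0 = 0 := by
  simp [logGeometric]

theorem logGeometric_ofReal {x : ℝ} (hx : x ≤ 1) : logGeometric k c d x
    = ((c * (x / (1 - x)) - d * Real.log (1 - x)) / k : ℝ) := by
  rw [logGeometric]
  push_cast [Complex.ofReal_log (sub_nonneg.2 hx)]
  rfl

theorem eulerDeriv_logGeometric [NeZero k] (hx : 1 - x ∈ Complex.slitPlane) :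
    eulerDeriv k (logGeometric k c d) x = c * x / (1 - x) ^ 2 + d * x / (1 - x) := by
  have hk : (k : ℂ) ≠ 0 := NeZero.ne _
  have hne : 1 - x ≠ 0 := Complex.slitPlane_ne_zero hx
  rw [eulerDeriv, (hasDerivAt_logGeometric hx).deriv]
  field_simp

end LogGeometric

/-- The exponent `log h` of the extremal mapping, in the variable `z ^ k`. -/
noncomputable def extremalLeft (k : ℕ) (α : ℝ) : ℂ → ℂ := logGeometric k (2 * (1 - α)) 1

/-- The exponent `log g` of the extremal mapping, in the variable `z ^ k`. -/
noncomputable def extremalRight (k : ℕ) (α : ℝ) : ℂ → ℂ :=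
  logGeometric k (2 * (1 - α)) (2 * α - 1)

section Extremal

variable {k : ℕ} {α : ℝ}

theorem re_extremalLeft_add_re_extremalRight (k : ℕ) (α : ℝ) {x : ℝ} (hx : x ≤ 1) :
    (extremalLeft k α x).re + (extremalRight k α x).re = growthExponent k α x := by
  rw [extremalLeft, extremalRight, logGeometric_ofReal hx, logGeometric_ofReal hx,
    Complex.ofReal_re, Complex.ofReal_re, growthExponent]
  ring

theorem continuousAt_logharmonicMap_extremal {z : ℂ} (hz : 1 - z ^ k ∈ Complex.slitPlane) :
    ContinuousAt (logharmonicMap k (extremalLeft k α) (extremalRight k α)) z := by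
  have hexp (c d : ℝ) : ContinuousAt (fun w => Complex.exp (logGeometric k c d (w ^ k))) z :=
    (ContinuousAt.comp (g := logGeometric k c d) (f := fun w => w ^ k)
      (hasDerivAt_logGeometric hz).continuousAt (continuous_pow k).continuousAt).cexp
  exact (continuousAt_id.mul (hexp _ _)).mul (Complex.continuous_conj.continuousAt.comp (hexp _ _))

variable [NeZero k]

theorem one_add_eulerDeriv_extremalLeft {x : ℂ} (hx : x ∈ ball (0 : ℂ) 1) :
    1 + eulerDeriv k (extremalLeft k α) x = (1 + (1 - 2 * α) * x) / (1 - x) ^ 2 := by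
  have hs := one_sub_mem_slitPlane hx
  have hne : 1 - x ≠ 0 := Complex.slitPlane_ne_zero hs
  rw [extremalLeft, eulerDeriv_logGeometric hs]
  push_cast
  field_simp
  ring

theorem eulerDeriv_extremalRight {x : ℂ} (hx : x ∈ ball (0 : ℂ) 1) :
    eulerDeriv k (extremalRight k α) x = x * ((1 + (1 - 2 * α) * x) / (1 - x) ^ 2) := by
  have hs := one_sub_mem_slitPlane hx
  have hne : 1 - x ≠ 0 := Complex.slitPlane_ne_zero hs
  rw [extremalRight, eulerDeriv_logGeometric hs]
  push_cast
  field_simp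
  ring

theorem lt_re_one_add_mul_div_one_sub (hα1 : α < 1) {x : ℂ} (hx : x ∈ ball (0 : ℂ) 1) :
    α < ((1 + (1 - 2 * α) * x) / (1 - x)).re := by
  have hne : 1 - x ≠ 0 := Complex.slitPlane_ne_zero (one_sub_mem_slitPlane hx)
  have hsplit : (1 + (1 - 2 * α) * x) / (1 - x)
      = (2 * (1 - α) : ℝ) * (1 - x)⁻¹ - (1 - 2 * α : ℝ) := by
    push_cast
    field_simp
    ring
  rw [hsplit, Complex.sub_re, Complex.re_ofReal_mul, Complex.ofReal_re]
  linarith [mul_lt_mul_of_pos_left (one_half_lt_re_inv_one_sub hx) (sub_pos.2 hα1)]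

theorem isStarlikePair_extremal (hα0 : 0 ≤ α) (hα1 : α < 1) :
    IsStarlikePair k α (extremalLeft k α) (extremalRight k α) where
  differentiableOn_left := hasDiskSeries_logGeometric.differentiableOn
  differentiableOn_right := hasDiskSeries_logGeometric.differentiableOn
  left_zero := logGeometric_zero
  right_zero := logGeometric_zero
  lt_re x hx := by
    have hne : 1 - x ≠ 0 := Complex.slitPlane_ne_zero (one_sub_mem_slitPlane hx)
    rw [one_add_eulerDeriv_extremalLeft hx, eulerDeriv_extremalRight hx]
    convert! lt_re_one_add_mul_div_one_sub hα1 hx using 2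
    field_simp
  norm_lt x hx := by
    have hne : 1 - x ≠ 0 := Complex.slitPlane_ne_zero (one_sub_mem_slitPlane hx)
    have hnum : 1 + (1 - 2 * α) * x ≠ 0 := fun h => by
      have := lt_re_one_add_mul_div_one_sub hα1 hx
      rw [h, zero_div, Complex.zero_re] at this
      exact this.not_ge hα0
    rw [one_add_eulerDeriv_extremalLeft hx, eulerDeriv_extremalRight hx, norm_mul]
    exact mul_lt_of_lt_one_left (norm_pos_iff.2 (div_ne_zero hnum (pow_ne_zero 2 hne)))
      (mem_ball_zero_iff.1 hx)

theorem logharmonicMap_extremal_pow {z : ℂ} (hz : z ∈ ball (0 : ℂ) 1) :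
    logharmonicMap k (extremalLeft k α) (extremalRight k α) z ^ k
      = halfPlaneMap (1 - 2 * α) (1 - z ^ k)⁻¹ := by
  have hs := one_sub_mem_slitPlane ((pow_mem_ball_zero_one_iff (m := k)).2 hz)
  have hne : 1 - z ^ k ≠ 0 := Complex.slitPlane_ne_zero hs
  have hk : (k : ℂ) ≠ 0 := NeZero.ne _
  rw [logharmonicMap, halfPlaneMap, mul_pow, mul_pow, ← map_pow, ← Complex.exp_nat_mul,
    ← Complex.exp_nat_mul, extremalLeft, extremalRight, logGeometric, logGeometric,
    Complex.log_inv _ (Complex.slitPlane_arg_ne_pi hs), mul_div_cancel₀ _ hk,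
    mul_div_cancel₀ _ hk, ← Complex.exp_conj]
  set x := z ^ k
  have hsub : (1 - x)⁻¹ - 1 = x * Complex.exp (-Complex.log (1 - x)) := by
    rw [Complex.exp_neg, Complex.exp_log hne]
    field_simp
    ring
  have hquot : x / (1 - x) = (1 - x)⁻¹ - 1 := by field_simp; ring
  rw [hsub, mul_assoc, mul_assoc, ← Complex.exp_add, ← Complex.exp_add, hquot,
    Complex.re_eq_add_conj]
  simp only [map_sub, map_mul, Complex.conj_ofReal, map_one, map_neg]
  push_cast
  ring_nf

theorem logharmonicMap_extremal_injOn (hα0 : 0 ≤ α) (hα1 : α < 1) :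
    InjOn (logharmonicMap k (extremalLeft k α) (extremalRight k α)) (ball 0 1) := by
  intro z hz w hw h
  have hmem {v : ℂ} (hv : v ∈ ball (0 : ℂ) 1) : (1 - v ^ k)⁻¹ ∈ {y : ℂ | 1 / 2 < y.re} :=
    one_half_lt_re_inv_one_sub (pow_mem_ball_zero_one_iff.2 hv)
  have hinv : (1 - z ^ k)⁻¹ = (1 - w ^ k)⁻¹ := by
    refine halfPlaneMap_injOn (β := 1 - 2 * α) (by linarith) (by linarith) (hmem hz) (hmem hw) ?_
    rw [← logharmonicMap_extremal_pow hz, ← logharmonicMap_extremal_pow hw, h]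
  have hpow : z ^ k = w ^ k := sub_right_inj.1 (inv_injective hinv)
  rw [logharmonicMap, logharmonicMap, hpow] at h
  exact mul_right_cancel₀ (Complex.exp_ne_zero _)
    (mul_right_cancel₀ ((map_ne_zero _).2 (Complex.exp_ne_zero _)) h)

/-- The extremal mapping comes closest to the origin at the boundary points with `ζ ^ k = -1`. -/
theorem boundaryDist_extremal_le (hα0 : 0 ≤ α) (hα1 : α < 1) :
    boundaryDist (logharmonicMap k (extremalLeft k α) (extremalRight k α))
      ≤ coveringRadius k α := by
  obtain ⟨ζ, hζ⟩ := IsAlgClosed.exists_pow_nat_eq (-1 : ℂ) (NeZero.pos k)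
  have hnorm : ‖ζ‖ = 1 := (pow_eq_one_iff_of_nonneg (norm_nonneg ζ) (NeZero.ne k)).1 (by
    rw [← norm_pow, hζ, norm_neg, norm_one])
  have hradial : Tendsto (fun t : ℝ => (t : ℂ) * ζ) (𝓝[<] 1) (𝓝 ζ) := by
    have : Continuous fun t : ℝ => (t : ℂ) * ζ := by fun_prop
    simpa using (this.tendsto 1).mono_left nhdsWithin_le_nhds
  have hcont : ContinuousAt (logharmonicMap k (extremalLeft k α) (extremalRight k α)) ζ :=
    continuousAt_logharmonicMap_extremal (by rw [hζ]; exact .inl (by norm_num))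
  refine ((isStarlikePair_extremal hα0 hα1).boundaryDist_le_norm_of_tendsto
    (logharmonicMap_extremal_injOn hα0 hα1) ?_ hnorm hradial (hcont.tendsto.comp hradial)).trans_eq
    ?_
  · filter_upwards [Ioo_mem_nhdsLT zero_lt_one] with t ht
    simpa [hnorm, abs_of_pos ht.1] using ht.2
  · have hexp := re_extremalLeft_add_re_extremalRight k α (x := -1) (by norm_num)
    rw [Complex.ofReal_neg, Complex.ofReal_one] at hexp
    rw [norm_logharmonicMap, hnorm, hζ, one_mul, hexp, growthExponent, coveringRadius]
    norm_num
    ring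

theorem hasSum_bohrTerm_extremal (hα0 : 0 ≤ α) (hα1 : α ≤ 1) {r : ℝ} (hr : r ∈ Ico (0 : ℝ) 1) :
    HasSum (bohrTerm k (fun m => logGeometricCoeff k (2 * (1 - α)) 1 (m / k))
      (fun m => logGeometricCoeff k (2 * (1 - α)) (2 * α - 1) (m / k)) 0 r)
      (growthExponent k α (r ^ k)) := by
  have hcoeff (n : ℕ) : logGeometricCoeff k (2 * (1 - α)) 1 (n + 1)
      + logGeometricCoeff k (2 * (1 - α)) (2 * α - 1) (n + 1)
      = ((4 * (1 - α) + 2 * α / (n + 1)) / k : ℝ) := by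
    simp only [logGeometricCoeff, Nat.succ_ne_zero, if_false]
    push_cast
    ring
  have : 0 ≤ 1 - α := sub_nonneg.2 hα1
  refine (hasSum_log_geometric k (4 * (1 - α)) (2 * α) (pow_mem_Ico_zero_one hr)).congr_fun
    fun n => ?_
  rw [bohrTerm, Nat.mul_div_cancel _ (NeZero.pos k), Complex.ofReal_zero, zero_mul,
    Complex.exp_zero, one_mul, hcoeff, Complex.norm_real, Complex.norm_real,
    Real.norm_of_nonneg hr.1, Real.norm_of_nonneg (by positivity), mul_comm (n + 1) k, pow_mul]

theorem norm_one_add_eulerDeriv_extremalLeft_ofReal (hα1 : α ≤ 1) {x : ℝ}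
    (hx : x ∈ Ico (0 : ℝ) 1) :
    ‖1 + eulerDeriv k (extremalLeft k α) x‖ = distortionFactor α x := by
  rw [one_add_eulerDeriv_extremalLeft (by simpa [abs_of_nonneg hx.1] using hx.2),
    ← Real.norm_of_nonneg (zero_le_one.trans (one_le_distortionFactor hα1 hx)),
    ← Complex.norm_real, distortionFactor]
  push_cast
  rfl

theorem bohrMajorant_extremal (hα0 : 0 ≤ α) (hα1 : α < 1) {r : ℝ} (hr : r ∈ Ico (0 : ℝ) 1) :
    bohrMajorant k (logharmonicMap k (extremalLeft k α) (extremalRight k α))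
      (fun m => logGeometricCoeff k (2 * (1 - α)) 1 (m / k))
      (fun m => logGeometricCoeff k (2 * (1 - α)) (2 * α - 1) (m / k)) 0 r
      = sharpMajorant k α r := by
  have hP := isStarlikePair_extremal (k := k) hα0 hα1
  have hx : r ^ k ∈ Ico (0 : ℝ) 1 := pow_mem_Ico_zero_one hr
  have hnorm : ‖(r : ℂ)‖ = r := by rw [Complex.norm_real, Real.norm_of_nonneg hr.1]
  rw [bohrMajorant, (hasSum_bohrTerm_extremal hα0 hα1.le hr).tsum_eq,
    mul_wirtingerZ_logharmonicMap hP.differentiableOn_left hP.differentiableOn_right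
      (mem_ball_zero_iff.2 (hnorm.trans_lt hr.2)),
    norm_mul, norm_logharmonicMap, ← Complex.ofReal_pow,
    re_extremalLeft_add_re_extremalRight k α hx.2.le,
    norm_one_add_eulerDeriv_extremalLeft_ofReal hα1.le hx, hnorm, sharpMajorant]
  ring

theorem exists_extremal (hα0 : 0 ≤ α) (hα1 : α < 1) :
    ∃ (f h g ω : ℂ → ℂ) (a b : ℕ → ℂ), IsSLHkStar k α f h g ω a b ∧ ω 0 = 0 ∧
      boundaryDist f ≤ coveringRadius k α ∧
      ∀ r ∈ Ico (0 : ℝ) 1, bohrMajorant k f a b 0 r = sharpMajorant k α r := by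
  refine ⟨_, _, _, _, _, _, (isStarlikePair_extremal hα0 hα1).isSLHkStar hasDiskSeries_logGeometric
    hasDiskSeries_logGeometric (logharmonicMap_extremal_injOn hα0 hα1), ?_,
    boundaryDist_extremal_le hα0 hα1, fun r hr => bohrMajorant_extremal hα0 hα1 hr⟩
  simp only [zero_pow (NeZero.ne k), eulerDeriv_zero, zero_div]

theorem boundaryDist_congr {f g : ℂ → ℂ} (h : EqOn f g unitDisk) :
    boundaryDist f = boundaryDist g := by
  rw [boundaryDist, boundaryDist, h.image_eq, h (mem_ball_self one_pos)]

theorem bohrMajorant_congr {k : ℕ} {f g : ℂ → ℂ} {a b : ℕ → ℂ} {θ : ℝ} {z : ℂ}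
    (h : EqOn f g unitDisk) (hz : z ∈ unitDisk) :
    bohrMajorant k f a b θ z = bohrMajorant k g a b θ z := by
  rw [bohrMajorant, bohrMajorant,
    wirtingerZ_congr (h.eventuallyEq_of_mem (isOpen_ball.mem_nhds hz))]

theorem IsSLHkStar.summable_and_bohrMajorant_le {f h g ω : ℂ → ℂ} {a b : ℕ → ℂ} (hα0 : 0 ≤ α)
    (hα1 : α < 1) (hS : IsSLHkStar k α f h g ω a b) (θ : ℝ) {z : ℂ} (hz : z ∈ unitDisk) :
    Summable (bohrTerm k a b θ z) ∧ bohrMajorant k f a b θ z ≤ sharpMajorant k α ‖z‖ := by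
  obtain ⟨A, B, hP, hf, hA, hB⟩ := hS.exists_isStarlikePair hα0 hα1
  rw [bohrMajorant_congr hf hz]
  exact ⟨hP.summable_bohrTerm θ hA hB hz, hP.bohrMajorant_le_sharpMajorant θ hA hB hz⟩

theorem IsSLHkStar.coveringRadius_le_boundaryDist {f h g ω : ℂ → ℂ} {a b : ℕ → ℂ} (hα0 : 0 ≤ α)
    (hα1 : α < 1) (hS : IsSLHkStar k α f h g ω a b) : coveringRadius k α ≤ boundaryDist f := by
  obtain ⟨A, B, hP, hf, -, -⟩ := hS.exists_isStarlikePair hα0 hα1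
  rw [boundaryDist_congr hf]
  exact hP.coveringRadius_le_boundaryDist hα0 (hS.univalent.congr hf)

end Extremal

theorem mainTheorem6 (k : ℕ) (hk : 1 ≤ k) (α : ℝ) (hα0 : 0 ≤ α) (hα1 : α < 1) :
    ∃ r₆ : ℝ,
      (r₆ ∈ Set.Ioo (0 : ℝ) 1 ∧ radiusFunction k α r₆ = 1 ∧
        ∀ r ∈ Set.Ioo (0 : ℝ) 1, radiusFunction k α r = 1 → r = r₆) ∧
      (∀ (f h g ω : ℂ → ℂ) (a b : ℕ → ℂ), IsSLHkStar k α f h g ω a b → ω 0 = 0 →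
        ∀ (θ : ℝ) (z : ℂ), ‖z‖ ≤ r₆ →
          Summable (bohrTerm k a b θ z) ∧
          bohrMajorant k f a b θ z ≤ boundaryDist f) ∧
      (∀ ρ ∈ Set.Ioo r₆ 1,
        ∃ (f h g ω : ℂ → ℂ) (a b : ℕ → ℂ), IsSLHkStar k α f h g ω a b ∧ ω 0 = 0 ∧
          ∃ (θ : ℝ) (z : ℂ), ‖z‖ = ρ ∧
            boundaryDist f < bohrMajorant k f a b θ z) := by
  have : NeZero k := ⟨by omega⟩
  obtain ⟨r₆, hr₆, hroot⟩ := exists_radiusFunction_eq_one (k := k) hα0 hα1.le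
  have hr : r₆ ∈ Ico (0 : ℝ) 1 := Ioo_subset_Ico_self hr₆
  have hsharp : sharpMajorant k α r₆ = coveringRadius k α := by
    rw [← coveringRadius_mul_radiusFunction α hr, hroot, mul_one]
  have hmono : StrictMonoOn (sharpMajorant k α) (Ico 0 1) := sharpMajorant_strictMonoOn hα0 hα1.le
  refine ⟨r₆, ⟨hr₆, hroot, fun r hrI hr1 => ?_⟩, fun f h g ω a b hS _ θ z hz => ?_, fun ρ hρ => ?_⟩
  · exact (radiusFunction_strictMonoOn hα0 hα1.le).injOn (Ioo_subset_Ico_self hrI) hr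
      (hr1.trans hroot.symm)
  · have hz1 : ‖z‖ < 1 := hz.trans_lt hr₆.2
    obtain ⟨hsummable, hle⟩ :=
      hS.summable_and_bohrMajorant_le hα0 hα1 θ (mem_ball_zero_iff.2 hz1)
    exact ⟨hsummable, hle.trans ((hmono.monotoneOn ⟨norm_nonneg z, hz1⟩ hr hz).trans
      (hsharp.trans_le (hS.coveringRadius_le_boundaryDist hα0 hα1)))⟩
  · obtain ⟨f, h, g, ω, a, b, hS, hω, hdist, hmajorant⟩ := exists_extremal (k := k) hα0 hα1
    have hρ' : ρ ∈ Ico (0 : ℝ) 1 := ⟨hr.1.trans hρ.1.le, hρ.2⟩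
    refine ⟨f, h, g, ω, a, b, hS, hω, 0, ρ, ?_, ?_⟩
    · rw [Complex.norm_real, Real.norm_of_nonneg hρ'.1]
    · rw [hmajorant ρ hρ']
      exact hdist.trans_lt (hsharp ▸ hmono hr hρ' hρ.1)
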